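/- Let $X$ be a CW complex of finite type (finitely many cells in each dimension) whose base point is a vertex, and let $Y_1$ and $Y_2$ be pointed countable CW complexes (countably many cells). A pointed map $f\colon X\to Y$ is called a phantom map if for every $n\ge 0$ its restriction to the $n$-skeleton $X_n$ is pointed null-homotopic; write $\mathrm{Ph}(X,Y)\subseteq[X,Y]$ for the set of pointed homotopy classes of phantom maps from $X$ to $Y$, and $*$ for the class of the constant map. Suppose that the loop spaces $\Omega Y_1$ and $\Omega Y_2$ at the base points are homotopy equivalent as topological spaces (the equivalence need not preserve base points or loop multiplication). Then $\mathrm{Ph}(X,Y_1)=\{*\}$ if and only if $\mathrm{Ph}(X,Y_2)=\{*\}$. -/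

import Mathlib

namespace PhantomMaps

open Topology

universe u v

/-- The `n`-skeleton of a CW complex `X`, as a subset of `X`, for a natural number `n`. -/
def skel (X : Type u) [TopologicalSpace X] [T2Space X] [CWComplex (Set.univ : Set X)] (n : ℕ) : Set X :=
  (CWComplex.skeleton (Set.univ : Set X) (n : ℕ∞) : Set X)

theorem skel_mono (X : Type u) [TopologicalSpace X] [T2Space X] [CWComplex (Set.univ : Set X)]
    {m n : ℕ} (h : m ≤ n) : skel X m ⊆ skel X n :=
  CWComplex.skeleton_mono (C := (Set.univ : Set X)) (Nat.cast_le.mpr h)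

/-- A CW complex is countable if the set of all its cells is countable. -/
class CountableCW (Y : Type u) [TopologicalSpace Y] [CWComplex (Set.univ : Set Y)] : Prop where
  countable_cells : Countable (Σ n : ℕ, RelCWComplex.cell (Set.univ : Set Y) n)

/-- Pointed continuous maps `(X, x₀) → (Y, y₀)`. -/
def PointedMap {X : Type u} {Y : Type v} [TopologicalSpace X] [TopologicalSpace Y]
    (x₀ : X) (y₀ : Y) : Type (max u v) :=
  {f : C(X, Y) // f x₀ = y₀}

section

variable {X : Type u} {Y : Type v} [TopologicalSpace X] [TopologicalSpace Y]

/-- The constant pointed map. -/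
def PointedMap.trivial (x₀ : X) (y₀ : Y) : PointedMap x₀ y₀ :=
  ⟨ContinuousMap.const X y₀, rfl⟩

/-- Restriction of a pointed map to a subspace containing the base point. -/
def PointedMap.restrict {x₀ : X} {y₀ : Y} (f : PointedMap x₀ y₀) (A : Set X) (h : x₀ ∈ A) :
    PointedMap (⟨x₀, h⟩ : A) y₀ :=
  ⟨f.1.restrict A, f.2⟩

/-- Pointed homotopy: homotopy relative to the base point. -/
instance pointedHomotopySetoid (x₀ : X) (y₀ : Y) : Setoid (PointedMap x₀ y₀) where
  r f g := f.1.HomotopicRel g.1 {x₀}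
  iseqv :=
    ⟨fun f => ContinuousMap.HomotopicRel.refl f.1, fun h => h.symm, fun h h' => h.trans h'⟩

/-- The set `[X, Y]` of pointed homotopy classes of pointed maps `(X, x₀) → (Y, y₀)`. -/
def HomotopyClasses (x₀ : X) (y₀ : Y) : Type (max u v) :=
  Quotient (pointedHomotopySetoid x₀ y₀)

/-- The pointed homotopy class of a pointed map. -/
def PointedMap.homotopyClass {x₀ : X} {y₀ : Y} (f : PointedMap x₀ y₀) : HomotopyClasses x₀ y₀ :=
  Quotient.mk (pointedHomotopySetoid x₀ y₀) f

/-- The class of the constant map, the base point `*` of `[X, Y]`. -/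
def HomotopyClasses.trivial (x₀ : X) (y₀ : Y) : HomotopyClasses x₀ y₀ :=
  (PointedMap.trivial x₀ y₀).homotopyClass

variable [T2Space X] [CWComplex (Set.univ : Set X)]

/-- A pointed map out of a CW complex (with base point a vertex) is a phantom map if its
restriction to the `n`-skeleton is pointed null-homotopic for every `n`. -/
def IsPhantom {x₀ : X} (hx₀ : x₀ ∈ skel X 0) {y₀ : Y} (f : PointedMap x₀ y₀) : Prop :=
  ∀ n : ℕ, (f.restrict (skel X n) (skel_mono X (Nat.zero_le n) hx₀)).homotopyClass =
    HomotopyClasses.trivial _ y₀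

/-- `Ph(X, Y) ⊆ [X, Y]`, the set of pointed homotopy classes of phantom maps. -/
def Ph {x₀ : X} (hx₀ : x₀ ∈ skel X 0) (y₀ : Y) : Set (HomotopyClasses x₀ y₀) :=
  {c | ∃ f : PointedMap x₀ y₀, IsPhantom hx₀ f ∧ f.homotopyClass = c}

end

end PhantomMaps

/-!
Triviality of phantom maps depends only on the homotopy type of the loop space of the target.

For a CW complex `X` of finite type and a pointed space `(Y, y)`, let `G n = LoopGroup X y n` be the
fundamental group of the mapping space `C(skel X n, Y)` at the constant map. Restriction makes these
groups a tower. The set of phantom classes is trivial if and only if `lim¹` of this tower is trivial,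
and for countable groups this is equivalent to the Mittag-Leffler condition
(`ph_eq_singleton_iff_mittagLeffler`). The Mittag-Leffler condition only involves the underlying
tower of sets, and as a set `G n` is the set of free homotopy classes of maps from `skel X n` to the
loop space of `Y`. Hence it is invariant under homotopy equivalences of loop spaces which respect
neither base points nor multiplication (`mittagLeffler_of_homotopyEquiv`).

If the tower is Mittag-Leffler and `f` is a phantom map, the null-homotopies of `f` on the skeleta
can be corrected by elements of the groups `G n` until consecutive ones are compatible up to
homotopy. The restriction maps between the mapping spaces are fibrations, so the null-homotopies can
then be chosen strictly compatible (`homotopicRel_const_of_mittagLeffler`). Conversely, path lifting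
produces from any sequence of elements of the groups `G n` a phantom map whose null-homotopies have
the given differences; if it is null-homotopic, then the sequence is trivial in `lim¹`
(`exists_twisted_section_of_phantom`). If the Mittag-Leffler condition fails, a diagonal argument
against an enumeration of `G n` gives a nontrivial element of `lim¹`
(`mittagLeffler_of_exists_twisted_section`).

The groups `G n` are countable because `Y` is countable (`countable_loopGroup`). A loop in
`C(skel X n, Y)` takes values in a finite subcomplex `S` of `Y`, the loops with values in `S` form a
second countable space, and nearby loops are homotopic. The last fact follows from the property
`LocHomotopic` of `S`: two maps from a compact Hausdorff space to `S` which are close are homotopic.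
It is proved by attaching one cell at a time (`IsCellAttachment.eventually_homotopic`).
-/

namespace PhantomMaps

open Topology Set Metric unitInterval Filter

set_option linter.unusedSectionVars false

/-! ### Towers of sets and of groups -/

section Tower

variable {Q : ℕ → Type*} (τ : ∀ n, Q (n + 1) → Q n)

/-- In a tower of sets `⋯ → Q (n + 1) → Q n → ⋯ → Q 0`, the property that an element of `Q n` lies
in the image of `Q (n + k)`. The recursion avoids maps between `Q (n + k)` and `Q n`. -/
def Lifts : ℕ → ∀ n, Q n → Prop
  | 0, _, _ => True
  | k + 1, n, x => ∃ y, τ n y = x ∧ Lifts k (n + 1) y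

/-- The Mittag-Leffler condition: for every `n` the decreasing images of `Q (n + k)` in `Q n`
are eventually constant. -/
def MittagLeffler : Prop :=
  ∀ n, ∃ k, ∀ x, Lifts τ k n x → ∀ j, Lifts τ j n x

variable {τ}

theorem Lifts.of_succ : ∀ {k n} {x : Q n}, Lifts τ (k + 1) n x → Lifts τ k n x
  | 0, _, _, _ => trivial
  | _ + 1, _, _, ⟨y, hy, h⟩ => ⟨y, hy, h.of_succ⟩

theorem Lifts.of_le {k j n : ℕ} {x : Q n} (hkj : k ≤ j) (h : Lifts τ j n x) : Lifts τ k n x := by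
  induction hkj with
  | refl => exact h
  | step _ ih => exact ih h.of_succ

theorem exists_lifts (hQ : ∀ n, Nonempty (Q n)) : ∀ k n, ∃ x : Q n, Lifts τ k n x
  | 0, n => (hQ n).elim fun x => ⟨x, trivial⟩
  | k + 1, n => (exists_lifts hQ k (n + 1)).elim fun y hy => ⟨τ n y, y, rfl, hy⟩

/-- A tower of nonempty sets with the Mittag-Leffler property has a nonempty limit: the stable
images form a tower of nonempty sets and surjections. -/
theorem MittagLeffler.exists_section (h : MittagLeffler τ) (hQ : ∀ n, Nonempty (Q n)) :
    ∃ x : ∀ n, Q n, ∀ n, τ n (x (n + 1)) = x n := by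
  have step : ∀ n (x : {x : Q n // ∀ j, Lifts τ j n x}),
      ∃ y : {y : Q (n + 1) // ∀ j, Lifts τ j (n + 1) y}, τ n y.1 = x.1 := by
    rintro n ⟨x, hx⟩
    obtain ⟨k, hk⟩ := h (n + 1)
    obtain ⟨y, hy, hyk⟩ := hx (k + 1)
    exact ⟨⟨y, hk y hyk⟩, hy⟩
  have start : ∃ x : Q 0, ∀ j, Lifts τ j 0 x := by
    obtain ⟨k, hk⟩ := h 0
    obtain ⟨x, hx⟩ := exists_lifts (τ := τ) hQ k 0
    exact ⟨x, hk x hx⟩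
  choose next hnext using step
  let s : ∀ n, {x : Q n // ∀ j, Lifts τ j n x} :=
    fun n => Nat.rec ⟨start.choose, start.choose_spec⟩ (fun n x => next n x) n
  exact ⟨fun n => (s n).1, fun n => hnext n (s n)⟩

variable {Q' : ℕ → Type*} {τ' : ∀ n, Q' (n + 1) → Q' n}

theorem Lifts.map (e : ∀ n, Q n → Q' n) (he : ∀ n x, τ' n (e (n + 1) x) = e n (τ n x)) :
    ∀ {k n} {x : Q n}, Lifts τ k n x → Lifts τ' k n (e n x)
  | 0, _, _, _ => trivial
  | _ + 1, _, _, ⟨y, hy, h⟩ => ⟨e _ y, by rw [he, hy], h.map e he⟩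

theorem MittagLeffler.of_equiv (e : ∀ n, Q n ≃ Q' n)
    (he : ∀ n x, τ' n (e (n + 1) x) = e n (τ n x)) (h : MittagLeffler τ) : MittagLeffler τ' := by
  intro n
  obtain ⟨k, hk⟩ := h n
  have he' : ∀ n x, τ n ((e (n + 1)).symm x) = (e n).symm (τ' n x) := fun n x => by
    rw [Equiv.eq_symm_apply, ← he, Equiv.apply_symm_apply]
  refine ⟨k, fun x hx j => ?_⟩
  have := (hk _ (hx.map (fun n => (e n).symm) he') j).map (fun n => e n) he
  simpa using this

end Tower

section GroupTower

variable {G : ℕ → Type*} [∀ n, Group (G n)] (ρ : ∀ n, G (n + 1) →* G n)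

/-- The transition maps of a tower of groups, twisted by right translations. The limits of these
twisted towers are the obstructions to the triviality of `lim¹`. -/
def twist (a : ∀ n, G n) (n : ℕ) (y : G (n + 1)) : G n := ρ n y * a n

variable {ρ}

theorem twist_one : twist ρ (fun _ => 1) = fun n => ⇑(ρ n) := by
  funext n y
  simp [twist]

theorem lifts_twist_congr {a b : ∀ n, G n} : ∀ {k n} {x : G n}, (∀ m, n ≤ m → a m = b m) →
    Lifts (twist ρ a) k n x → Lifts (twist ρ b) k n x
  | 0, _, _, _, _ => trivial
  | _ + 1, n, _, hab, ⟨y, hy, h⟩ =>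
    ⟨y, by rw [← hy, twist, twist, hab n le_rfl],
      lifts_twist_congr (fun m hm => hab m (by omega)) h⟩

theorem lifts_twist_congr_of_lt {a b : ∀ n, G n} : ∀ {k n} {x : G n},
    (∀ m, m < n + k → a m = b m) → Lifts (twist ρ a) k n x → Lifts (twist ρ b) k n x
  | 0, _, _, _, _ => trivial
  | _ + 1, n, _, hab, ⟨y, hy, h⟩ =>
    ⟨y, by rw [← hy, twist, twist, hab n (by omega)],
      lifts_twist_congr_of_lt (fun m hm => hab m (by omega)) h⟩

theorem Lifts.mul_inv_of_twist {a : ∀ n, G n} : ∀ {k n} {x x' : G n}, Lifts (twist ρ a) k n x →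
    Lifts (twist ρ a) k n x' → Lifts (fun n => ρ n) k n (x' * x⁻¹)
  | 0, _, _, _, _, _ => trivial
  | _ + 1, _, _, _, ⟨y, hy, h⟩, ⟨y', hy', h'⟩ =>
    ⟨y' * y⁻¹, by simp [← hy, ← hy', twist], h.mul_inv_of_twist h'⟩

theorem Lifts.mul_twist {a : ∀ n, G n} : ∀ {k n} {g x : G n}, Lifts (fun n => ρ n) k n g →
    Lifts (twist ρ a) k n x → Lifts (twist ρ a) k n (g * x)
  | 0, _, _, _, _, _ => trivial
  | _ + 1, _, _, _, ⟨y, hy, h⟩, ⟨y', hy', h'⟩ =>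
    ⟨y * y', by simp [← hy, ← hy', twist, mul_assoc], h.mul_twist h'⟩

theorem Lifts.mul {k n : ℕ} {g x : G n} (hg : Lifts (fun n => ρ n) k n g)
    (hx : Lifts (fun n => ρ n) k n x) : Lifts (fun n => ρ n) k n (g * x) := by
  rw [← twist_one] at hx
  have := hg.mul_twist hx
  rwa [twist_one] at this

theorem Lifts.inv {k n : ℕ} {g : G n} (hg : Lifts (fun n => ρ n) k n g) :
    Lifts (fun n => ρ n) k n g⁻¹ := by
  induction k generalizing n with
  | zero => trivial
  | succ k ih =>
    obtain ⟨y, hy, h⟩ := hg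
    exact ⟨y⁻¹, by simp [← hy], ih h⟩

/-- `lim¹` of a Mittag-Leffler tower of groups is trivial. -/
theorem MittagLeffler.exists_twisted_section (h : MittagLeffler (fun n => ρ n)) (a : ∀ n, G n) :
    ∃ x : ∀ n, G n, ∀ n, x n = ρ n (x (n + 1)) * a n := by
  -- The image of `G (n + k)` under the twisted maps is a coset of its image under `ρ`.
  have tw : MittagLeffler (twist ρ a) := by
    intro n
    obtain ⟨k, hk⟩ := h n
    refine ⟨k, fun x hx j => ?_⟩
    obtain ⟨z, hz⟩ := exists_lifts (τ := twist ρ a) (fun n => ⟨1⟩) (max k j) n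
    have := hk _ ((hz.of_le (le_max_left _ _)).mul_inv_of_twist hx) j
    simpa using this.mul_twist (hz.of_le (le_max_right _ _))
  obtain ⟨x, hx⟩ := tw.exists_section (fun n => ⟨1⟩)
  exact ⟨x, fun n => (hx n).symm⟩

/-- The twisting sequence `a` can be altered in the indices `≥ n + k` in two ways, such that the
entries at `n` of solutions for the two sequences always differ by a given element `x` of the image
of `G (n + k)`, up to factors in the image of `G (n + J)`. -/
theorem exists_twist_pair (J : ℕ) : ∀ (k n : ℕ) (x : G n), Lifts (fun n => ρ n) k n x →
    ∀ a : ∀ n, G n, ∃ a₁ a₂ : ∀ n, G n, (∀ m, m < n + k → a₁ m = a m) ∧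
      (∀ m, m < n + k → a₂ m = a m) ∧ ∃ J' : ℕ, ∀ e₁ e₂ : G n, Lifts (twist ρ a₁) J' n e₁ →
        Lifts (twist ρ a₂) J' n e₂ → ∃ i i' : G n, Lifts (fun n => ρ n) J n i ∧
          Lifts (fun n => ρ n) J n i' ∧ e₂ * e₁⁻¹ = i * x * i' := by
  intro k
  induction k with
  | zero =>
    intro n x _ a
    let a₁ : ∀ n, G n := fun m => if m < n then a m else 1
    refine ⟨a₁, Function.update a₁ n x, fun m hm => if_pos hm, fun m hm => ?_, J + 1, ?_⟩
    · rw [Function.update_of_ne (by omega)]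
      exact if_pos hm
    · rintro e₁ e₂ h₁ ⟨y, hy, h₂⟩
      have h₁' : Lifts (fun n => ρ n) (J + 1) n e₁ := by
        rw [← twist_one]
        exact lifts_twist_congr (fun m hm => if_neg (by omega)) h₁
      have h₂' : Lifts (fun n => ρ n) J (n + 1) y := by
        rw [← twist_one]
        refine lifts_twist_congr (fun m hm => ?_) h₂
        rw [Function.update_of_ne (by omega)]
        exact if_neg (by omega)
      refine ⟨ρ n y, e₁⁻¹, Lifts.of_succ ⟨y, rfl, h₂'⟩, h₁'.of_succ.inv, ?_⟩
      rw [← hy, twist, Function.update_self]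
  | succ k ih =>
    rintro n _ ⟨x, rfl, hx⟩ a
    obtain ⟨a₁, a₂, h₁, h₂, J', H⟩ := ih (n + 1) x hx a
    refine ⟨a₁, a₂, fun m hm => h₁ m (by omega), fun m hm => h₂ m (by omega), J' + 1, ?_⟩
    rintro _ _ ⟨y₁, rfl, hy₁⟩ ⟨y₂, rfl, hy₂⟩
    obtain ⟨i, i', hi, hi', hii'⟩ := H y₁ y₂ hy₁ hy₂
    refine ⟨ρ n i, ρ n i', Lifts.of_succ ⟨i, rfl, hi⟩, Lifts.of_succ ⟨i', rfl, hi'⟩, ?_⟩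
    simp only [twist, h₁ n (by omega), h₂ n (by omega)]
    rw [← map_mul, ← map_mul, ← hii']
    simp

/-- A tower of countable groups with trivial `lim¹` is Mittag-Leffler. If the images in `G n` do not
stabilize, then a twisting sequence can be built step by step, each step excluding one
element of the countable group `G n` as the entry at `n` of a solution. -/
theorem mittagLeffler_of_exists_twisted_section [∀ n, Countable (G n)]
    (h : ∀ a : ∀ n, G n, ∃ x : ∀ n, G n, ∀ n, x n = ρ n (x (n + 1)) * a n) :
    MittagLeffler (fun n => ρ n) := by
  by_contra hML
  simp only [MittagLeffler, not_forall, not_exists] at hML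
  obtain ⟨n, hn⟩ := hML
  have step : ∀ (e : G n) (s : (∀ m, G m) × ℕ), ∃ s' : (∀ m, G m) × ℕ, s.2 < s'.2 ∧
      (∀ m, m < n + s.2 → s'.1 m = s.1 m) ∧ ¬ Lifts (twist ρ s'.1) s'.2 n e := by
    rintro e ⟨a, k⟩
    obtain ⟨x, hx, J, hJ⟩ := hn k
    obtain ⟨a₁, a₂, h₁, h₂, J', H⟩ := exists_twist_pair J k n x hx a
    by_contra hcon
    -- otherwise `e` is allowed by both alterations, and then `x` lies in the image of `G (n + J)`
    have key : ∀ b : ∀ m, G m, (∀ m, m < n + k → b m = a m) → Lifts (twist ρ b) J' n e := by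
      intro b hb
      by_contra hbe
      exact hcon ⟨(b, max J' (k + 1)), lt_of_lt_of_le k.lt_succ_self (le_max_right _ _), hb,
        fun hl => hbe (hl.of_le (le_max_left _ _))⟩
    obtain ⟨i, i', hi, hi', hii'⟩ := H e e (key a₁ h₁) (key a₂ h₂)
    have hx' : x = i⁻¹ * i'⁻¹ := by
      rw [mul_inv_cancel] at hii'
      have := congrArg (fun z => i⁻¹ * z * i'⁻¹) hii'
      simpa [mul_assoc] using this.symm
    exact hJ (hx' ▸ hi.inv.mul hi'.inv)
  choose next hlt hagree hnot using step
  obtain ⟨e, he⟩ := exists_surjective_nat (G n)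
  let s : ℕ → (∀ m, G m) × ℕ := fun i => Nat.rec ((fun _ => 1), 0) (fun i s => next (e i) s) i
  have hs : ∀ i, s (i + 1) = next (e i) (s i) := fun _ => rfl
  have hmono : StrictMono fun i => (s i).2 := strictMono_nat_of_lt_succ fun i => hlt (e i) (s i)
  have hstab : ∀ i j, i ≤ j → ∀ m, m < n + (s i).2 → (s j).1 m = (s i).1 m := by
    intro i j hij m hm
    induction j, hij using Nat.le_induction with
    | base => rfl
    | succ j hij ih =>
      have hle : (s i).2 ≤ (s j).2 := hmono.monotone hij
      rw [hs, hagree _ _ m (by omega), ih]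
  obtain ⟨x, hx⟩ := h fun m => (s (m + 1)).1 m
  obtain ⟨i, hi⟩ := he (x n)
  have hlift : ∀ k l, Lifts (twist ρ fun m => (s (m + 1)).1 m) k l (x l) := by
    intro k
    induction k with
    | zero => exact fun _ => trivial
    | succ k ih => exact fun l => ⟨x (l + 1), (hx l).symm, ih (l + 1)⟩
  apply hnot (e i) (s i)
  rw [← hs, hi]
  refine lifts_twist_congr_of_lt (fun m hm => ?_) (hlift (s (i + 1)).2 n)
  rcases le_total (i + 1) (m + 1) with hle | hle
  · exact hstab _ _ hle m hm
  · exact (hstab _ _ hle m (by have : m + 1 ≤ (s (m + 1)).2 := hmono.id_le (m + 1); omega)).symm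

end GroupTower

/-! ### Gluing and extending continuous maps -/

section Glue

theorem continuousOn_ite_le {A Z : Type*} [TopologicalSpace A] [TopologicalSpace Z] {s : Set A}
    {f g : A → Z} {u v : A → ℝ} (hu : ContinuousOn u s) (hv : ContinuousOn v s)
    (hf : ContinuousOn f (s ∩ {x | u x ≤ v x})) (hg : ContinuousOn g (s ∩ {x | v x ≤ u x}))
    (h : ∀ x ∈ s, u x = v x → f x = g x) :
    ContinuousOn (fun x => if u x ≤ v x then f x else g x) s := by
  rw [continuousOn_iff_continuous_domRestrict]
  have hu' := continuousOn_iff_continuous_domRestrict.1 hu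
  have hv' := continuousOn_iff_continuous_domRestrict.1 hv
  refine continuous_if_le (f' := fun x : s => f x) (g' := fun x : s => g x) hu' hv' ?_ ?_ ?_
  · exact hf.comp continuous_subtype_val.continuousOn fun x hx => ⟨x.2, hx⟩
  · exact hg.comp continuous_subtype_val.continuousOn fun x hx => ⟨x.2, hx⟩
  · exact fun x hx => h x x.2 hx

/-- A continuous map on a compact set is a quotient map onto its image. -/
theorem continuousOn_image_of_comp {A B Z : Type*} [TopologicalSpace A] [TopologicalSpace B]
    [TopologicalSpace Z] [T2Space B] {K : Set A} (hK : IsCompact K) {φ : A → B}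
    (hφ : ContinuousOn φ K) {g : B → Z} (hg : ContinuousOn (g ∘ φ) K) :
    ContinuousOn g (φ '' K) := by
  have : CompactSpace K := isCompact_iff_compactSpace.1 hK
  have hφ' : Continuous (fun x : K => (⟨φ x, mem_image_of_mem φ x.2⟩ : φ '' K)) :=
    (continuousOn_iff_continuous_domRestrict.1 hφ).subtype_mk _
  have hq : IsQuotientMap (fun x : K => (⟨φ x, mem_image_of_mem φ x.2⟩ : φ '' K)) := by
    refine (hφ'.isClosedMap).isQuotientMap hφ' ?_
    rintro ⟨_, x, hx, rfl⟩
    exact ⟨⟨x, hx⟩, rfl⟩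
  rw [continuousOn_iff_continuous_domRestrict, hq.continuous_iff]
  exact continuousOn_iff_continuous_domRestrict.1 hg

/-- The homotopy extension property of the pair (ball, sphere) in a normed space: a map on
`ball × 0 ∪ sphere × [0, 1]` extends to `ball × [0, 1]`, by central projection from `(0, 2)`. -/
theorem exists_extension_cylinder {E Z : Type*} [NormedAddCommGroup E] [NormedSpace ℝ E]
    [TopologicalSpace Z] (a : E → Z) (b : E × ℝ → Z) (ha : ContinuousOn a (closedBall 0 1))
    (hb : ContinuousOn b (sphere 0 1 ×ˢ Icc 0 1)) (hab : ∀ x ∈ sphere (0 : E) 1, b (x, 0) = a x) :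
    ∃ c : E × ℝ → Z, ContinuousOn c (closedBall 0 1 ×ˢ Icc 0 1) ∧
      (∀ x ∈ closedBall (0 : E) 1, c (x, 0) = a x) ∧
      ∀ x ∈ sphere (0 : E) 1, ∀ t ∈ Icc (0 : ℝ) 1, c (x, t) = b (x, t) := by
  refine ⟨fun y => if 2 * ‖y.1‖ ≤ 2 - y.2 then a ((2 / (2 - y.2)) • y.1)
    else b (‖y.1‖⁻¹ • y.1, 2 - (2 - y.2) / ‖y.1‖), ?_, ?_, ?_⟩
  · apply continuousOn_ite_le (by fun_prop) (by fun_prop)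
    · refine ha.comp (ContinuousOn.smul (ContinuousOn.div (by fun_prop) (by fun_prop) ?_)
        (by fun_prop)) ?_
      · rintro ⟨x, t⟩ ⟨⟨_, ht⟩, _⟩
        simp only [mem_Icc] at ht ⊢
        linarith
      · rintro ⟨x, t⟩ ⟨⟨_, ht⟩, h⟩
        simp only [mem_Icc, mem_ofPred_eq, mem_closedBall_zero_iff] at ht h ⊢
        have : (0 : ℝ) < 2 - t := by linarith
        rw [norm_smul, Real.norm_of_nonneg (by positivity), div_mul_eq_mul_div, div_le_one this]
        exact h
    · have hne : ∀ y ∈ (closedBall (0 : E) 1 ×ˢ Icc (0 : ℝ) 1) ∩ {y | 2 - y.2 ≤ 2 * ‖y.1‖},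
          ‖y.1‖ ≠ 0 := by
        rintro ⟨x, t⟩ ⟨⟨_, ht⟩, h⟩
        simp only [mem_Icc, mem_ofPred_eq] at ht h ⊢
        intro h0
        rw [h0] at h
        linarith
      refine hb.comp (ContinuousOn.prodMk ?_ ?_) ?_
      · exact ContinuousOn.smul (ContinuousOn.inv₀ (by fun_prop) hne) (by fun_prop)
      · exact ContinuousOn.sub (by fun_prop) (ContinuousOn.div (by fun_prop) (by fun_prop) hne)
      · intro y hy
        have h0 := hne y hy
        obtain ⟨x, t⟩ := y
        obtain ⟨⟨hx, ht⟩, h⟩ := hy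
        simp only [mem_Icc, mem_ofPred_eq, mem_closedBall_zero_iff] at hx ht h h0
        have hpos : 0 < ‖x‖ := lt_of_le_of_ne (norm_nonneg x) (Ne.symm h0)
        refine ⟨?_, ?_⟩
        · simp [norm_smul, h0]
        · have h1 : (2 - t) / ‖x‖ ≤ 2 := by rw [div_le_iff₀ hpos]; exact h
          have h2 : 1 ≤ (2 - t) / ‖x‖ := by rw [le_div_iff₀ hpos]; linarith
          constructor <;> simp only <;> linarith
    · rintro ⟨x, t⟩ ⟨hx, ht⟩ h
      simp only [mem_Icc] at ht h ⊢
      have hpos : 0 < ‖x‖ := by linarith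
      have hx1 : (2 - t) = 2 * ‖x‖ := h.symm
      rw [hx1]
      have e1 : 2 / (2 * ‖x‖) = ‖x‖⁻¹ := by field_simp
      have e2 : 2 - 2 * ‖x‖ / ‖x‖ = 0 := by field_simp; ring
      rw [e1, e2, hab]
      simp [norm_smul, hpos.ne']
  · intro x hx
    simp only [mem_closedBall_zero_iff] at hx
    simp only [sub_zero]
    rw [if_pos (by linarith)]
    norm_num
  · intro x hx t ht
    simp only [mem_sphere_zero_iff_norm] at hx
    simp only [hx, div_one, inv_one, one_smul, sub_sub_cancel, mul_one]
    split_ifs with h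
    · have : t = 0 := le_antisymm (by linarith) ht.1
      subst this
      rw [hab x (by simpa using hx)]
      norm_num
    · rfl

end Glue

/-! ### Maps out of a CW complex of finite type -/

section Skeleta

variable {X : Type*} [TopologicalSpace X] [T2Space X] [CWComplex (univ : Set X)]

theorem isClosed_skel (n : ℕ) : IsClosed (skel X n) :=
  RelCWComplex.Subcomplex.closed _

theorem closedCell_subset_skel (n : ℕ) (e : RelCWComplex.cell (univ : Set X) n) :
    RelCWComplex.closedCell n e ⊆ skel X n :=
  RelCWComplex.closedCell_subset_skeleton n e

theorem skel_succ (n : ℕ) : skel X (n + 1) =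
    skel X n ∪ ⋃ e : RelCWComplex.cell (univ : Set X) (n + 1), RelCWComplex.closedCell (n + 1) e :=
  (RelCWComplex.skeleton_union_iUnion_closedCell_eq_skeleton_succ n).symm

theorem skel_zero : skel X 0 =
    ⋃ e : RelCWComplex.cell (univ : Set X) 0, RelCWComplex.closedCell 0 e := by
  have h := RelCWComplex.skeletonLT_union_iUnion_closedCell_eq_skeletonLT_succ
    (C := (univ : Set X)) 0
  have h0 : (RelCWComplex.skeletonLT (univ : Set X) ((0 : ℕ) : ℕ∞) : Set X) = ∅ := by
    simpa using CWComplex.skeletonLT_zero_eq_empty (C := (univ : Set X))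
  rw [h0, empty_union] at h
  exact h.symm

theorem iUnion_skel : ⋃ n, skel X n = univ :=
  RelCWComplex.iUnion_skeleton_eq_complex (C := (univ : Set X))

variable {Z : Type*} [TopologicalSpace Z]

theorem continuousOn_closedCell {g : X → Z} {n : ℕ} {e : RelCWComplex.cell (univ : Set X) n}
    (h : ContinuousOn (g ∘ RelCWComplex.map n e) (closedBall 0 1)) :
    ContinuousOn g (RelCWComplex.closedCell n e) :=
  continuousOn_image_of_comp (isCompact_closedBall 0 1) (RelCWComplex.continuousOn n e) h

theorem continuous_of_continuousOn_skel {g : X → Z} (h : ∀ n, ContinuousOn g (skel X n)) :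
    Continuous g := by
  rw [continuous_iff_isClosed]
  intro s hs
  refine (CWComplex.closed (univ : Set X) _ (subset_univ _)).2 fun n e => ?_
  rw [inter_comm]
  exact ((h n).mono (closedCell_subset_skel n e)).preimage_isClosed_of_isClosed
    RelCWComplex.isClosed_closedCell hs

variable [CWComplex.FiniteType (univ : Set X)]

instance (n : ℕ) : Finite (RelCWComplex.cell (univ : Set X) n) :=
  CWComplex.FiniteType.finite_cell n

theorem isCompact_skel (n : ℕ) : IsCompact (skel X n) := by
  induction n with
  | zero =>
    rw [skel_zero]
    exact isCompact_iUnion fun e => RelCWComplex.isCompact_closedCell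
  | succ n ih =>
    rw [skel_succ]
    exact ih.union (isCompact_iUnion fun e => RelCWComplex.isCompact_closedCell)

instance (n : ℕ) : CompactSpace (skel X n) := isCompact_iff_compactSpace.1 (isCompact_skel n)

theorem finite_skel_zero : (skel X 0).Finite := by
  rw [skel_zero]
  refine finite_iUnion fun e => ?_
  refine Set.Finite.image _ ?_
  exact Set.toFinite _

theorem continuousOn_skel_succ {g : X → Z} {n : ℕ} (h₀ : ContinuousOn g (skel X n))
    (h : ∀ e : RelCWComplex.cell (univ : Set X) (n + 1),
      ContinuousOn g (RelCWComplex.closedCell (n + 1) e)) :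
    ContinuousOn g (skel X (n + 1)) := by
  rw [skel_succ]
  refine h₀.union_of_isClosed ?_ (isClosed_skel n)
    (isClosed_iUnion_of_finite fun e => RelCWComplex.isClosed_closedCell)
  exact (locallyFinite_of_finite _).continuousOn_iUnion
    (fun e => RelCWComplex.isClosed_closedCell) h

/-- A map on the `n`-skeleton and maps on the closed `n + 1`-cells, compatible on the boundaries,
can be glued to a map on the `n + 1`-skeleton. -/
theorem exists_glue_skel_succ {n : ℕ} (g₀ : X → Z) (hg₀ : ContinuousOn g₀ (skel X n))
    (ge : RelCWComplex.cell (univ : Set X) (n + 1) → (Fin (n + 1) → ℝ) → Z)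
    (hge : ∀ e, ContinuousOn (ge e) (closedBall 0 1))
    (hcompat : ∀ e, ∀ v ∈ sphere 0 1, ge e v = g₀ (RelCWComplex.map (n + 1) e v)) :
    ∃ g : X → Z, ContinuousOn g (skel X (n + 1)) ∧ EqOn g g₀ (skel X n) ∧
      ∀ e, ∀ v ∈ closedBall 0 1, g (RelCWComplex.map (n + 1) e v) = ge e v := by
  classical
  let g : X → Z := fun x => if x ∈ skel X n then g₀ x else
    if h : ∃ e : RelCWComplex.cell (univ : Set X) (n + 1), x ∈ RelCWComplex.openCell (n + 1) e then
      ge h.choose ((RelCWComplex.map (n + 1) h.choose).symm x) else g₀ x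
  have hg : EqOn g g₀ (skel X n) := fun x hx => if_pos hx
  have hcell : ∀ e, ∀ v ∈ closedBall 0 1, g (RelCWComplex.map (n + 1) e v) = ge e v := by
    intro e v hv
    rw [← sphere_union_ball] at hv
    rcases hv with hv | hv
    · rw [hcompat e v hv]
      exact hg (RelCWComplex.cellFrontier_subset_skeleton n e (mem_image_of_mem _ hv))
    · have hmem : RelCWComplex.map (n + 1) e v ∈ RelCWComplex.openCell (n + 1) e :=
        mem_image_of_mem _ hv
      have hnot : RelCWComplex.map (n + 1) e v ∉ skel X n := fun h =>
        (RelCWComplex.disjoint_skeleton_openCell (C := (univ : Set X)) (n := n) (j := e)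
          (by exact_mod_cast n.lt_succ_self)).le_bot ⟨h, hmem⟩
      have hex : ∃ e' : RelCWComplex.cell (univ : Set X) (n + 1),
          RelCWComplex.map (n + 1) e v ∈ RelCWComplex.openCell (n + 1) e' := ⟨e, hmem⟩
      have he : hex.choose = e := by
        by_contra hne
        exact (RelCWComplex.disjoint_openCell_of_ne (C := (univ : Set X))
          (by simpa using hne)).le_bot ⟨hex.choose_spec, hmem⟩
      simp only [g]
      rw [if_neg hnot, dif_pos hex, he, PartialEquiv.left_inv]
      rwa [RelCWComplex.source_eq]
  refine ⟨g, continuousOn_skel_succ (hg₀.congr hg) fun e => continuousOn_closedCell ?_, hg, hcell⟩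
  exact (hge e).congr fun v hv => hcell e v hv

end Skeleta

/-! ### The restriction fibrations between mapping spaces of skeleta -/

theorem exists_continuousOn_extend {A Z : Type*} [TopologicalSpace A] [TopologicalSpace Z]
    [Nonempty Z] {s : Set A} (f : C(s, Z)) :
    ∃ f' : A → Z, ContinuousOn f' s ∧ ∀ x : s, f' x = f x := by
  have h : ∀ x : s, Function.extend Subtype.val f (fun _ => Classical.arbitrary Z) x.1 = f x :=
    fun x => Subtype.val_injective.extend_apply _ _ x
  refine ⟨_, ?_, h⟩
  rw [continuousOn_iff_continuous_domRestrict]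
  exact f.continuous.congr fun x => (h x).symm

/-- The homotopy extension property of the pair (ball, sphere), for bundled maps. -/
theorem exists_extension_cylinder' {E Z : Type*} [NormedAddCommGroup E] [NormedSpace ℝ E]
    [TopologicalSpace Z] (a : C(closedBall (0 : E) 1, Z)) (b : C(sphere (0 : E) 1 × I, Z))
    (hab : ∀ x, b (x, 0) = a ⟨x, sphere_subset_closedBall x.2⟩) :
    ∃ c : C(closedBall (0 : E) 1 × I, Z), (∀ x, c (x, 0) = a x) ∧
      ∀ (x : sphere (0 : E) 1) (t : I), c (⟨x, sphere_subset_closedBall x.2⟩, t) = b (x, t) := by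
  have : Nonempty Z := ⟨a ⟨0, by simp⟩⟩
  obtain ⟨a', ha', haa'⟩ := exists_continuousOn_extend a
  let j : C(↥(sphere (0 : E) 1 ×ˢ Icc (0 : ℝ) 1), sphere (0 : E) 1 × I) :=
    ⟨fun y => (⟨y.1.1, y.2.1⟩, ⟨y.1.2, y.2.2⟩), by fun_prop⟩
  obtain ⟨b', hb', hbb'⟩ := exists_continuousOn_extend (b.comp j)
  have hb'' : ∀ (x : sphere (0 : E) 1) (t : I), b' (x, t) = b (x, t) :=
    fun x t => hbb' ⟨(x, t), x.2, t.2⟩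
  obtain ⟨c, hc, h₀, h₁⟩ := exists_extension_cylinder a' b' ha' hb' fun x hx => by
    have h1 := hb'' ⟨x, hx⟩ 0
    have h2 := haa' ⟨x, sphere_subset_closedBall hx⟩
    simp only [Icc.coe_zero] at h1 h2
    rw [h1, h2, hab]
  refine ⟨⟨fun y => c (y.1, y.2), ?_⟩, fun x => ?_, fun x t => ?_⟩
  · exact hc.comp_continuous (by fun_prop) fun y => ⟨y.1.2, y.2.2⟩
  · exact (h₀ x x.2).trans (haa' x)
  · exact (h₁ x x.2 t t.2).trans (hb'' x t)

/-- The homotopy extension property of the pair formed by `ball × [0, 1]` and its boundary, for a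
homotopy which is constant on `ball × {0, 1}`. The points of `I × I` are pairs `(t, s)` with `t` the
homotopy parameter. -/
theorem exists_extension_square {E Z : Type*} [NormedAddCommGroup E] [NormedSpace ℝ E]
    [TopologicalSpace Z] (a : C(closedBall (0 : E) 1 × I, Z))
    (b : C(sphere (0 : E) 1 × (I × I), Z))
    (h₀ : ∀ v s, b (v, (0, s)) = a (⟨v, sphere_subset_closedBall v.2⟩, s))
    (hs₀ : ∀ v t, b (v, (t, 0)) = a (⟨v, sphere_subset_closedBall v.2⟩, 0))
    (hs₁ : ∀ v t, b (v, (t, 1)) = a (⟨v, sphere_subset_closedBall v.2⟩, 1)) :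
    ∃ c : C(closedBall (0 : E) 1 × (I × I), Z), (∀ v s, c (v, (0, s)) = a (v, s)) ∧
      (∀ v t, c (v, (t, 0)) = a (v, 0)) ∧ (∀ v t, c (v, (t, 1)) = a (v, 1)) ∧
      ∀ (v : sphere (0 : E) 1) (y : I × I),
        c (⟨v, sphere_subset_closedBall v.2⟩, y) = b (v, y) := by
  classical
  have hZ : Nonempty Z := ⟨a (⟨0, by simp⟩, 0)⟩
  -- `closedBall 0 1 × [-1, 1]` is the unit ball of `E × ℝ`; `κ` rescales `[-1, 1]` to `[0, 1]`
  let κ : ℝ → I := fun s => projIcc 0 1 zero_le_one ((s + 1) / 2)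
  have hκ : Continuous κ := continuous_projIcc.comp (by fun_prop)
  have hκ₁ : κ 1 = 1 := by simp [κ]
  have hκ₀ : κ (-1) = 0 := by simp [κ]
  have hκκ : ∀ s : I, κ (2 * s - 1) = s := fun s => by simp [κ]
  have hball : ∀ y : E × ℝ, y ∈ closedBall (0 : E × ℝ) 1 ↔ ‖y.1‖ ≤ 1 ∧ |y.2| ≤ 1 := by
    intro y
    simp [Prod.norm_def]
  obtain ⟨a', ha', haa'⟩ := exists_continuousOn_extend (s := closedBall (0 : E) 1 ×ˢ univ)
    (a.comp ⟨fun y => (⟨y.1.1, y.2.1⟩, y.1.2), by fun_prop⟩)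
  replace haa' : ∀ v (hv : v ∈ closedBall (0 : E) 1) s, a' (v, s) = a (⟨v, hv⟩, s) :=
    fun v hv s => haa' ⟨(v, s), hv, trivial⟩
  obtain ⟨b', hb', hbb'⟩ := exists_continuousOn_extend (s := sphere (0 : E) 1 ×ˢ univ)
    (b.comp ⟨fun y => (⟨y.1.1, y.2.1⟩, y.1.2), by fun_prop⟩)
  replace hbb' : ∀ v (hv : v ∈ sphere (0 : E) 1) y, b' (v, y) = b (⟨v, hv⟩, y) :=
    fun v hv y => hbb' ⟨(v, y), hv, trivial⟩
  have hA : ContinuousOn (fun y : E × ℝ => a' (y.1, κ y.2)) (closedBall 0 1) := by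
    refine ha'.comp (by fun_prop) fun y hy => ⟨?_, trivial⟩
    simpa using ((hball y).1 hy).1
  let β : (E × ℝ) × ℝ → Z := fun y => if ‖y.1.1‖ = 1 then
    b' (y.1.1, (projIcc 0 1 zero_le_one y.2, κ y.1.2)) else a' (y.1.1, κ y.1.2)
  have hβ₁ : ∀ y : (E × ℝ) × ℝ, |y.1.2| = 1 → β y = a' (y.1.1, κ y.1.2) := by
    rintro ⟨⟨v, s⟩, t⟩ hs
    simp only [β]
    split_ifs with hv
    · have hv' : v ∈ sphere (0 : E) 1 := by simpa using hv
      rw [hbb' _ hv', haa' _ (sphere_subset_closedBall hv')]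
      rcases eq_or_eq_neg_of_abs_eq hs with rfl | rfl
      · rw [hκ₁, hs₁]
      · rw [hκ₀, hs₀]
    · rfl
  have hβ : ContinuousOn β (sphere 0 1 ×ˢ Icc 0 1) := by
    have hsub : sphere (0 : E × ℝ) 1 ×ˢ Icc (0 : ℝ) 1 ⊆
        {y | ‖y.1.1‖ = 1} ∪ {y | ‖y.1.1‖ ≤ 1 ∧ |y.1.2| = 1} := by
      rintro ⟨⟨v, s⟩, t⟩ ⟨h, -⟩
      simp only [mem_sphere_zero_iff_norm, Prod.norm_def, Real.norm_eq_abs] at h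
      simp only [mem_union, mem_ofPred_eq]
      rcases max_choice ‖v‖ |s| with hm | hm
      · exact Or.inl (hm.symm.trans h)
      · exact Or.inr ⟨h ▸ le_max_left _ _, hm.symm.trans h⟩
    refine ContinuousOn.mono (ContinuousOn.union_of_isClosed ?_ ?_ ?_ ?_) hsub
    · have : ContinuousOn (fun y : (E × ℝ) × ℝ =>
          b' (y.1.1, (projIcc 0 1 zero_le_one y.2, κ y.1.2))) {y | ‖y.1.1‖ = 1} := by
        refine hb'.comp (Continuous.continuousOn ?_) fun y hy => ⟨by simpa using hy, trivial⟩
        exact (by fun_prop : Continuous fun y : (E × ℝ) × ℝ => y.1.1).prodMk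
          ((continuous_projIcc.comp continuous_snd).prodMk (by fun_prop))
      exact this.congr fun y hy => if_pos hy
    · have : ContinuousOn (fun y : (E × ℝ) × ℝ => a' (y.1.1, κ y.1.2))
          {y | ‖y.1.1‖ ≤ 1 ∧ |y.1.2| = 1} :=
        ha'.comp (by fun_prop) fun y hy => ⟨by simpa using hy.1, trivial⟩
      exact this.congr fun y hy => hβ₁ y hy.2
    · have hn : Continuous fun y : (E × ℝ) × ℝ => ‖y.1.1‖ := by fun_prop
      exact isClosed_eq hn continuous_const
    · have hn : Continuous fun y : (E × ℝ) × ℝ => ‖y.1.1‖ := by fun_prop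
      have ha : Continuous fun y : (E × ℝ) × ℝ => |y.1.2| := by fun_prop
      exact (isClosed_le hn continuous_const).inter (isClosed_eq ha continuous_const)
  have hβ₀ : ∀ y ∈ sphere (0 : E × ℝ) 1, β (y, 0) = a' (y.1, κ y.2) := by
    rintro ⟨v, s⟩ -
    simp only [β]
    split_ifs with hv
    · have hv' : v ∈ sphere (0 : E) 1 := by simpa using hv
      rw [hbb' _ hv', haa' _ (sphere_subset_closedBall hv'), projIcc_left]
      exact h₀ _ _
    · rfl
  obtain ⟨c, hc, hc₀, hcβ⟩ := exists_extension_cylinder _ β hA hβ hβ₀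
  have habs : ∀ s : I, |2 * (s : ℝ) - 1| ≤ 1 := fun s => by
    rw [abs_le]; constructor <;> linarith [s.2.1, s.2.2]
  have hmem : ∀ (v : closedBall (0 : E) 1) (s : I),
      ((v : E), 2 * (s : ℝ) - 1) ∈ closedBall (0 : E × ℝ) 1 := fun v s =>
    (hball _).2 ⟨mem_closedBall_zero_iff.1 v.2, habs s⟩
  have hsph : ∀ (v : closedBall (0 : E) 1) (s : I), ‖(v : E)‖ = 1 ∨ |2 * (s : ℝ) - 1| = 1 →
      ((v : E), 2 * (s : ℝ) - 1) ∈ sphere (0 : E × ℝ) 1 := by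
    intro v s h
    have hv : ‖(v : E)‖ ≤ 1 := mem_closedBall_zero_iff.1 v.2
    simp only [mem_sphere_zero_iff_norm, Prod.norm_def, Real.norm_eq_abs]
    rcases h with h | h
    · rw [h, max_eq_left (habs s)]
    · rw [h, max_eq_right hv]
  refine ⟨⟨fun y => c ((y.1, 2 * (y.2.2 : ℝ) - 1), y.2.1), ?_⟩, fun v s => ?_, fun v t => ?_,
    fun v t => ?_, fun v y => ?_⟩
  · exact hc.comp_continuous (by fun_prop) fun y => ⟨hmem y.1 y.2.2, y.2.1.2⟩
  · change c (((v : E), 2 * (s : ℝ) - 1), ((0 : I) : ℝ)) = _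
    rw [Icc.coe_zero, hc₀ _ (hmem v s), hκκ]
    exact haa' v v.2 s
  · change c (((v : E), 2 * ((0 : I) : ℝ) - 1), (t : ℝ)) = _
    rw [hcβ _ (hsph v 0 (by simp)) t t.2, hβ₁ _ (by simp), hκκ]
    exact haa' v v.2 0
  · change c (((v : E), 2 * ((1 : I) : ℝ) - 1), (t : ℝ)) = _
    rw [hcβ _ (hsph v 1 (by norm_num)) t t.2, hβ₁ _ (by norm_num), hκκ]
    exact haa' v v.2 1
  · have hv : ‖(v : E)‖ = 1 := mem_sphere_zero_iff_norm.1 v.2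
    change c (((v : E), 2 * (y.2 : ℝ) - 1), (y.1 : ℝ)) = _
    rw [hcβ _ (hsph ⟨v, sphere_subset_closedBall v.2⟩ y.2 (Or.inl hv)) y.1 y.1.2]
    simp only [β]
    rw [if_pos hv, hκκ, projIcc_val]
    exact hbb' v v.2 y

section

variable {X : Type*} [TopologicalSpace X] [T2Space X] [CWComplex (univ : Set X)]

/-- The inclusion of the `n`-skeleton into the `n + 1`-skeleton. -/
def skelIncl (X : Type*) [TopologicalSpace X] [T2Space X] [CWComplex (univ : Set X)] (n : ℕ) :
    C(skel X n, skel X (n + 1)) :=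
  ⟨fun x => ⟨x, skel_mono X n.le_succ x.2⟩, by fun_prop⟩

/-- The characteristic map of an `n`-cell, as a map into the `n`-skeleton. -/
def charMap (n : ℕ) (e : RelCWComplex.cell (univ : Set X) n) :
    C(closedBall (0 : Fin n → ℝ) 1, skel X n) :=
  ⟨fun v => ⟨RelCWComplex.map n e v, closedCell_subset_skel n e (mem_image_of_mem _ v.2)⟩,
    (continuousOn_iff_continuous_domRestrict.1 (RelCWComplex.continuousOn n e)).subtype_mk _⟩

/-- The attaching map of an `n + 1`-cell. -/
def attachMap (n : ℕ) (e : RelCWComplex.cell (univ : Set X) (n + 1)) :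
    C(sphere (0 : Fin (n + 1) → ℝ) 1, skel X n) :=
  ⟨fun v => ⟨RelCWComplex.map (n + 1) e v,
      RelCWComplex.cellFrontier_subset_skeleton n e (mem_image_of_mem _ v.2)⟩,
    (continuousOn_iff_continuous_domRestrict.1 ((RelCWComplex.continuousOn (n + 1) e).mono
      sphere_subset_closedBall)).subtype_mk _⟩

theorem skelIncl_attachMap (n : ℕ) (e : RelCWComplex.cell (univ : Set X) (n + 1))
    (v : sphere (0 : Fin (n + 1) → ℝ) 1) : skelIncl X n (attachMap n e v) =
      charMap (n + 1) e ⟨v, sphere_subset_closedBall v.2⟩ := rfl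

theorem skel_succ_cases {n : ℕ} (x : skel X (n + 1)) : (∃ y, skelIncl X n y = x) ∨
    ∃ e v, charMap (n + 1) e v = x := by
  obtain ⟨x, hx⟩ := x
  have hx' := hx
  rw [skel_succ] at hx'
  rcases hx' with h | h
  · exact Or.inl ⟨⟨x, h⟩, rfl⟩
  · obtain ⟨e, v, hv, rfl⟩ := mem_iUnion.1 h
    exact Or.inr ⟨e, ⟨v, hv⟩, rfl⟩

variable [CWComplex.FiniteType (univ : Set X)]

/-- Gluing of maps on the `n`-skeleton and on the `n + 1`-cells, for bundled maps. -/
theorem exists_glue_skel_succ' {Z : Type*} [TopologicalSpace Z] [Nonempty Z] {n : ℕ}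
    (g₀ : C(skel X n, Z))
    (ge : RelCWComplex.cell (univ : Set X) (n + 1) → C(closedBall (0 : Fin (n + 1) → ℝ) 1, Z))
    (h : ∀ e (v : sphere (0 : Fin (n + 1) → ℝ) 1),
      ge e ⟨v, sphere_subset_closedBall v.2⟩ = g₀ (attachMap n e v)) :
    ∃ g : C(skel X (n + 1), Z), (∀ x, g (skelIncl X n x) = g₀ x) ∧
      ∀ e v, g (charMap (n + 1) e v) = ge e v := by
  obtain ⟨g₀', hg₀', hg₀⟩ := exists_continuousOn_extend g₀
  choose ge' hge' hge using fun e => exists_continuousOn_extend (ge e)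
  obtain ⟨g, hg, h₀, he⟩ := exists_glue_skel_succ g₀' hg₀' ge' hge' fun e v hv =>
    ((hge e ⟨v, sphere_subset_closedBall hv⟩).trans (h e ⟨v, hv⟩)).trans
      (hg₀ (attachMap n e ⟨v, hv⟩)).symm
  refine ⟨⟨fun x => g x, continuousOn_iff_continuous_domRestrict.1 hg⟩,
    fun x => (h₀ x.2).trans (hg₀ x), fun e v => (he e v v.2).trans (hge e v)⟩

variable {Y : Type*} [TopologicalSpace Y]

/-- Restriction of maps from the `n + 1`-skeleton to the `n`-skeleton. -/
def res (X : Type*) [TopologicalSpace X] [T2Space X] [CWComplex (univ : Set X)] (Y : Type*)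
    [TopologicalSpace Y] (n : ℕ) : C(C(skel X (n + 1), Y), C(skel X n, Y)) :=
  ContinuousMap.compRightContinuousMap Y (skelIncl X n)

omit [CWComplex.FiniteType (univ : Set X)] in
theorem res_apply {n : ℕ} (f : C(skel X (n + 1), Y)) (x : skel X n) :
    res X Y n f x = f (skelIncl X n x) := rfl

/-- Path lifting for the restriction map `res`, which is the homotopy extension property of the
pair of consecutive skeleta. -/
theorem exists_path_lift {n : ℕ} [Nonempty Y] (f : C(skel X (n + 1), Y)) {g : C(skel X n, Y)}
    (p : Path (res X Y n f) g) :
    ∃ (g' : C(skel X (n + 1), Y)) (q : Path f g'), ∀ t, res X Y n (q t) = p t := by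
  have hcell : ∀ e : RelCWComplex.cell (univ : Set X) (n + 1),
      ∃ c : C(closedBall (0 : Fin (n + 1) → ℝ) 1 × I, Y),
        (∀ v, c (v, 0) = f (charMap (n + 1) e v)) ∧
        ∀ (v : sphere (0 : Fin (n + 1) → ℝ) 1) (t : I),
          c (⟨v, sphere_subset_closedBall v.2⟩, t) = p t (attachMap n e v) := by
    intro e
    refine exists_extension_cylinder' (f.comp (charMap (n + 1) e))
      ⟨fun y => p y.2 (attachMap n e y.1), by fun_prop⟩ fun v => ?_
    simp [res_apply, skelIncl_attachMap]
  choose c hc₀ hc using hcell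
  have : Nonempty C(I, Y) := ⟨ContinuousMap.const I (Classical.arbitrary Y)⟩
  obtain ⟨G, hG₀, hG⟩ := exists_glue_skel_succ' (Z := C(I, Y))
    (ContinuousMap.curry ⟨fun y : skel X n × I => p y.2 y.1, by fun_prop⟩)
    (fun e => (c e).curry) fun e v => by ext t; exact hc e v t
  have hGc : Continuous fun y : I × skel X (n + 1) => G y.2 y.1 := by fun_prop
  let q : C(I, C(skel X (n + 1), Y)) := ContinuousMap.curry ⟨_, hGc⟩
  have hq : ∀ t x, q t x = G x t := fun _ _ => rfl
  refine ⟨q 1, ⟨q, ?_, rfl⟩, fun t => ?_⟩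
  · ext x
    change q 0 x = f x
    rw [hq]
    rcases skel_succ_cases x with ⟨x, rfl⟩ | ⟨e, v, rfl⟩
    · rw [hG₀]
      change p 0 x = _
      rw [p.source]
      rfl
    · rw [hG]
      exact hc₀ e v
  · ext x
    change q t (skelIncl X n x) = _
    rw [hq, hG₀]
    rfl

/-- Lifting of a homotopy of paths, relative to the end points: a path homotopic to the restriction
of `q` lifts to a path homotopic to `q`. -/
theorem exists_path_lift_rel {n : ℕ} [Nonempty Y] {f g : C(skel X (n + 1), Y)} (q : Path f g)
    {p : Path (res X Y n f) (res X Y n g)}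
    (hp : Path.Homotopic (q.map (res X Y n).continuous) p) :
    ∃ q' : Path f g, q.Homotopic q' ∧ q'.map (res X Y n).continuous = p := by
  obtain ⟨H⟩ := hp
  have hH₀ : ∀ s, H (0, s) = res X Y n (q s) := fun s => H.apply_zero s
  have hH₁ : ∀ s, H (1, s) = p s := fun s => H.apply_one s
  have hs₀ : ∀ t, H (t, 0) = res X Y n f := fun t => Path.Homotopy.source H t
  have hs₁ : ∀ t, H (t, 1) = res X Y n g := fun t => Path.Homotopy.target H t
  have hcell := fun e : RelCWComplex.cell (univ : Set X) (n + 1) =>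
    exists_extension_square
      (⟨fun y => q y.2 (charMap (n + 1) e y.1), by fun_prop⟩ :
        C(closedBall (0 : Fin (n + 1) → ℝ) 1 × I, Y))
      ⟨fun y => H y.2 (attachMap n e y.1), by fun_prop⟩
      (fun v s => by
        change H (0, s) _ = _
        rw [hH₀]; rfl)
      (fun v t => by
        change H (t, 0) _ = q 0 _
        rw [hs₀, q.source]; rfl)
      (fun v t => by
        change H (t, 1) _ = q 1 _
        rw [hs₁, q.target]; rfl)
  choose c hc₀ hcs₀ hcs₁ hc using hcell
  have : Nonempty C(I × I, Y) := ⟨ContinuousMap.const _ (Classical.arbitrary Y)⟩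
  obtain ⟨G, hG₀, hG⟩ := exists_glue_skel_succ' (Z := C(I × I, Y))
    (ContinuousMap.curry ⟨fun y : skel X n × (I × I) => H y.2 y.1, by fun_prop⟩)
    (fun e => (c e).curry) fun e v => by ext y; exact hc e v y
  replace hG₀ : ∀ x y, G (skelIncl X n x) y = H y x := fun x y => by rw [hG₀]; rfl
  replace hG : ∀ e v y, G (charMap (n + 1) e v) y = c e (v, y) := fun e v y => by rw [hG]; rfl
  have hGc : Continuous fun y : (I × I) × skel X (n + 1) => G y.2 y.1 := by fun_prop
  let Q : C(I × I, C(skel X (n + 1), Y)) := ContinuousMap.curry ⟨_, hGc⟩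
  have hQ : ∀ y x, Q y x = G x y := fun _ _ => rfl
  have h₀ : ∀ s, Q (0, s) = q s := by
    intro s
    ext x
    rw [hQ]
    rcases skel_succ_cases x with ⟨x, rfl⟩ | ⟨e, v, rfl⟩
    · rw [hG₀, hH₀]; rfl
    · rw [hG, hc₀]; rfl
  have hf : ∀ t, Q (t, 0) = f := by
    intro t
    ext x
    rw [hQ]
    rcases skel_succ_cases x with ⟨x, rfl⟩ | ⟨e, v, rfl⟩
    · rw [hG₀, hs₀]; rfl
    · rw [hG, hcs₀]
      change q 0 _ = _
      rw [q.source]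
  have hg : ∀ t, Q (t, 1) = g := by
    intro t
    ext x
    rw [hQ]
    rcases skel_succ_cases x with ⟨x, rfl⟩ | ⟨e, v, rfl⟩
    · rw [hG₀, hs₁]; rfl
    · rw [hG, hcs₁]
      change q 1 _ = _
      rw [q.target]
  let q' : Path f g := ⟨⟨fun s => Q (1, s), by fun_prop⟩, hf 1, hg 1⟩
  refine ⟨q', ⟨⟨⟨Q, h₀, fun s => rfl⟩, ?_⟩⟩, ?_⟩
  · rintro t s (rfl | rfl)
    · exact (hf t).trans q.source.symm
    · exact (hg t).trans q.target.symm
  · ext s x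
    change Q (1, s) (skelIncl X n x) = _
    rw [hQ, hG₀, hH₁]

end

/-! ### Phantom maps and towers of fundamental groups of mapping spaces -/

section MapQuotient

variable {A B : Type*} [TopologicalSpace A] [TopologicalSpace B] {x y z : A} {x' y' z' : B}

/-- The image of a path under a continuous map, with prescribed names for the end points. -/
def mapPath (φ : C(A, B)) (hx : φ x = x') (hy : φ y = y') (p : Path x y) : Path x' y' :=
  (p.map φ.continuous).cast hx.symm hy.symm

/-- The image of a homotopy class of paths under a continuous map, with prescribed names for the
end points. -/
noncomputable def mapQ (φ : C(A, B)) (hx : φ x = x') (hy : φ y = y')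
    (p : Path.Homotopic.Quotient x y) : Path.Homotopic.Quotient x' y' :=
  (p.map φ).cast hx.symm hy.symm

theorem mapQ_mk (φ : C(A, B)) (hx : φ x = x') (hy : φ y = y') (p : Path x y) :
    mapQ φ hx hy (Path.Homotopic.Quotient.mk p) =
      Path.Homotopic.Quotient.mk (mapPath φ hx hy p) := rfl

theorem mapQ_trans (φ : C(A, B)) (hx : φ x = x') (hy : φ y = y') (hz : φ z = z')
    (p : Path.Homotopic.Quotient x y) (q : Path.Homotopic.Quotient y z) :
    mapQ φ hx hz (p.trans q) = (mapQ φ hx hy p).trans (mapQ φ hy hz q) := by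
  subst hx hy hz
  induction p using Path.Homotopic.Quotient.ind with | mk p =>
  induction q using Path.Homotopic.Quotient.ind with | mk q =>
  rw [← Path.Homotopic.Quotient.mk_trans, mapQ_mk, mapQ_mk, mapQ_mk,
    ← Path.Homotopic.Quotient.mk_trans]
  exact congrArg _ (Path.map_trans p q φ.continuous)

theorem mapQ_symm (φ : C(A, B)) (hx : φ x = x') (hy : φ y = y')
    (p : Path.Homotopic.Quotient x y) : mapQ φ hy hx p.symm = (mapQ φ hx hy p).symm := by
  subst hx hy
  induction p using Path.Homotopic.Quotient.ind with | mk p =>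
  rfl

theorem mapQ_mapQ {C : Type*} [TopologicalSpace C] {x'' y'' : C} (φ : C(A, B)) (ψ : C(B, C))
    (hx : φ x = x') (hy : φ y = y') (hx' : ψ x' = x'') (hy' : ψ y' = y'')
    (p : Path.Homotopic.Quotient x y) : mapQ ψ hx' hy' (mapQ φ hx hy p) =
      mapQ (ψ.comp φ) (by simp [hx, hx']) (by simp [hy, hy']) p := by
  subst hx hy hx' hy'
  induction p using Path.Homotopic.Quotient.ind with | mk p =>
  rfl

theorem mapQ_id (p : Path.Homotopic.Quotient x y) : mapQ (.id A) rfl rfl p = p := by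
  induction p using Path.Homotopic.Quotient.ind with | mk p =>
  rfl

theorem symm_trans_eq {w : A} (m : Path.Homotopic.Quotient x y) (g : Path.Homotopic.Quotient y z)
    (p : Path.Homotopic.Quotient x w) : m.symm.trans p = g.trans ((m.trans g).symm.trans p) := by
  generalize h : m.trans g = k
  have hg : g = m.symm.trans k := by
    rw [← h, ← Path.Homotopic.Quotient.trans_assoc, Path.Homotopic.Quotient.symm_trans,
      Path.Homotopic.Quotient.refl_trans]
  rw [hg, Path.Homotopic.Quotient.trans_assoc, ← Path.Homotopic.Quotient.trans_assoc k,
    Path.Homotopic.Quotient.trans_symm, Path.Homotopic.Quotient.refl_trans]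

end MapQuotient

section

variable {X : Type*} [TopologicalSpace X] [T2Space X] [CWComplex (univ : Set X)]

/-- Compatible maps on all skeleta are the restrictions of a map on the CW complex. -/
theorem exists_glue_skel {Z : Type*} [TopologicalSpace Z] (g : ∀ n, C(skel X n, Z))
    (h : ∀ n x, g (n + 1) (skelIncl X n x) = g n x) :
    ∃ G : C(X, Z), ∀ n (x : skel X n), G x = g n x := by
  have hmono : ∀ {m n : ℕ} (hmn : m ≤ n) (x : X) (hx : x ∈ skel X m),
      g n ⟨x, skel_mono X hmn hx⟩ = g m ⟨x, hx⟩ := by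
    intro m n hmn x hx
    induction n, hmn using Nat.le_induction with
    | base => rfl
    | succ n hmn ih => rw [← ih]; exact h n ⟨x, _⟩
  have hex : ∀ x : X, ∃ n, x ∈ skel X n := fun x => mem_iUnion.1 (iUnion_skel (X := X) ▸ mem_univ x)
  choose d hd using hex
  have hG : ∀ n (x : skel X n), g (d x) ⟨x, hd x⟩ = g n x := by
    intro n x
    rw [← hmono (le_max_left (d x) n) x (hd x), ← hmono (le_max_right (d x) n) x x.2]
  refine ⟨⟨fun x => g (d x) ⟨x, hd x⟩, continuous_of_continuousOn_skel fun n => ?_⟩, hG⟩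
  rw [continuousOn_iff_continuous_domRestrict]
  exact (g n).continuous.congr fun x => (hG n x).symm

variable {Y : Type*} [TopologicalSpace Y] {x₀ : X} (hx₀ : x₀ ∈ skel X 0)

/-- The base point of the `n`-skeleton. -/
def skelPt (n : ℕ) : skel X n := ⟨x₀, skel_mono X n.zero_le hx₀⟩

/-- Evaluation at the base point. -/
def evalPt (Y : Type*) [TopologicalSpace Y] (n : ℕ) : C(C(skel X n, Y), Y) :=
  ⟨fun f => f (skelPt hx₀ n), by fun_prop⟩

/-- The constant map from the `n`-skeleton with value `y`. -/
def cst (X : Type*) [TopologicalSpace X] [T2Space X] [CWComplex (univ : Set X)] {Y : Type*}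
    [TopologicalSpace Y] (n : ℕ) (y : Y) : C(skel X n, Y) := ContinuousMap.const _ y

/-- The continuous map sending a point to the constant map with this value. -/
def cst' (X : Type*) [TopologicalSpace X] [T2Space X] [CWComplex (univ : Set X)] (Y : Type*)
    [TopologicalSpace Y] (n : ℕ) : C(Y, C(skel X n, Y)) :=
  ⟨cst X n, ContinuousMap.continuous_const'⟩

/-- The group of free homotopy classes of maps from the `n`-skeleton of `X` to the loop space of `Y`
at `y`, realized as a fundamental group of the mapping space. -/
abbrev LoopGroup (X : Type*) [TopologicalSpace X] [T2Space X] [CWComplex (univ : Set X)]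
    {Y : Type*} [TopologicalSpace Y] (y : Y) (n : ℕ) : Type _ :=
  FundamentalGroup C(skel X n, Y) (cst X n y)

/-- The restriction homomorphisms between the groups `LoopGroup X y n`. -/
noncomputable def loopRes (X : Type*) [TopologicalSpace X] [T2Space X] [CWComplex (univ : Set X)]
    {Y : Type*} [TopologicalSpace Y] (y : Y) (n : ℕ) :
    LoopGroup X y (n + 1) →* LoopGroup X y n :=
  FundamentalGroup.map (res X Y n) (cst X (n + 1) y)

theorem res_cst (n : ℕ) (y : Y) : res X Y n (cst X (n + 1) y) = cst X n y := rfl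

theorem res_restrict (n : ℕ) (f : C(X, Y)) :
    res X Y n (f.restrict (skel X (n + 1))) = f.restrict (skel X n) := rfl

theorem evalPt_cst (n : ℕ) (y : Y) : evalPt hx₀ Y n (cst X n y) = y := rfl

theorem cst'_apply (n : ℕ) (y : Y) : cst' X Y n y = cst X n y := rfl

theorem loopRes_apply {y : Y} {n : ℕ} (g : LoopGroup X y (n + 1)) :
    loopRes X y n g = mapQ (res X Y n) (res_cst n y) (res_cst n y) g := by
  induction g using Path.Homotopic.Quotient.ind with | mk p =>
  rfl

/-- The class of a null-homotopy, followed by the inverse of the trace of the base point as a path of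
constant maps. The trace of the resulting class is trivial. -/
noncomputable def untrace {n : ℕ} {f : C(skel X n, Y)} {y : Y} (hf : evalPt hx₀ Y n f = y)
    (N : Path.Homotopic.Quotient f (cst X n y)) : Path.Homotopic.Quotient f (cst X n y) :=
  N.trans (mapQ (cst' X Y n) (cst'_apply n y) (cst'_apply n y)
    (mapQ (evalPt hx₀ Y n) hf (evalPt_cst hx₀ n y) N).symm)

theorem untrace_map_evalPt {n : ℕ} {f : C(skel X n, Y)} {y : Y} (hf : evalPt hx₀ Y n f = y)
    (N : Path.Homotopic.Quotient f (cst X n y)) :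
    mapQ (evalPt hx₀ Y n) hf (evalPt_cst hx₀ n y) (untrace hx₀ hf N) =
      Path.Homotopic.Quotient.refl y := by
  rw [untrace, mapQ_trans _ hf (evalPt_cst hx₀ n y) (evalPt_cst hx₀ n y), mapQ_mapQ]
  exact (congrArg _ (mapQ_id _)).trans (Path.Homotopic.Quotient.trans_symm _)

theorem untrace_map_res {n : ℕ} {f : C(skel X (n + 1), Y)} {f' : C(skel X n, Y)}
    (hff' : res X Y n f = f') {y : Y} (hf : evalPt hx₀ Y (n + 1) f = y)
    (hf' : evalPt hx₀ Y n f' = y) (N : Path.Homotopic.Quotient f (cst X (n + 1) y)) :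
    mapQ (res X Y n) hff' (res_cst n y) (untrace hx₀ hf N) =
      untrace hx₀ hf' (mapQ (res X Y n) hff' (res_cst n y) N) := by
  rw [untrace, mapQ_trans _ _ (res_cst n y), untrace, mapQ_mapQ, mapQ_mapQ]
  rfl

variable [CWComplex.FiniteType (univ : Set X)]

/-- `exists_path_lift_rel` in terms of homotopy classes. -/
theorem exists_path_lift_rel' {n : ℕ} {f g : C(skel X (n + 1), Y)} {f' g' : C(skel X n, Y)}
    [Nonempty Y] (hf : res X Y n f = f') (hg : res X Y n g = g') (q : Path f g) (p : Path f' g')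
    (hp : mapQ (res X Y n) hf hg (Path.Homotopic.Quotient.mk q) = Path.Homotopic.Quotient.mk p) :
    ∃ q' : Path f g, Path.Homotopic.Quotient.mk q' = Path.Homotopic.Quotient.mk q ∧
      mapPath (res X Y n) hf hg q' = p := by
  subst hf hg
  obtain ⟨q', hq', h⟩ := exists_path_lift_rel q (Path.Homotopic.Quotient.exact hp)
  exact ⟨q', Path.Homotopic.Quotient.eq.2 hq'.symm, h⟩

/-- A path in the mapping space whose trace at the base point is null-homotopic is homotopic to
a path of maps which are constant at the base point. -/
theorem exists_pointed_path {n : ℕ} : ∀ {f g : C(skel X n, Y)} (q : Path f g)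
    (p : Path (f (skelPt hx₀ n)) (g (skelPt hx₀ n))),
    Path.Homotopic (q.map (evalPt hx₀ Y n).continuous) p → (∀ t, p t = f (skelPt hx₀ n)) →
    ∃ q' : Path f g, q.Homotopic q' ∧ ∀ t, q' t (skelPt hx₀ n) = f (skelPt hx₀ n) := by
  classical
  induction n with
  | zero =>
    rintro f g q p ⟨H⟩ hp
    -- the `0`-skeleton is discrete, so the path can be altered at the base point alone
    have : Finite (skel X 0) := finite_skel_zero.to_subtype
    let F : (I × I) × skel X 0 → Y := fun y => if y.2 = skelPt hx₀ 0 then H y.1 else q y.1.2 y.2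
    have hF : Continuous F := by
      rw [continuous_prod_of_discrete_right]
      intro x
      by_cases hx : x = skelPt hx₀ 0
      · simp only [F, hx, if_true]
        exact H.continuous
      · simp only [F, hx, if_false]
        fun_prop
    let Q : C(I × I, C(skel X 0, Y)) := ContinuousMap.curry ⟨F, hF⟩
    have hQ : ∀ y x, Q y x = if x = skelPt hx₀ 0 then H y else q y.2 x := fun _ _ => rfl
    have h₀ : ∀ s, Q (0, s) = q s := by
      intro s
      ext x
      rw [hQ]
      split_ifs with hx
      · subst hx
        exact H.apply_zero s
      · rfl
    have hf : ∀ t, Q (t, 0) = f := by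
      intro t
      ext x
      rw [hQ]
      split_ifs with hx
      · subst hx
        exact Path.Homotopy.source H t
      · simp
    have hg : ∀ t, Q (t, 1) = g := by
      intro t
      ext x
      rw [hQ]
      split_ifs with hx
      · subst hx
        exact Path.Homotopy.target H t
      · simp
    let q' : Path f g := ⟨⟨fun s => Q (1, s), by fun_prop⟩, hf 1, hg 1⟩
    refine ⟨q', ⟨⟨⟨Q, h₀, fun s => rfl⟩, ?_⟩⟩, fun t => ?_⟩
    · rintro t s (rfl | rfl)
      · exact (hf t).trans q.source.symm
      · exact (hg t).trans q.target.symm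
    · change Q (1, t) _ = _
      rw [hQ, if_pos rfl]
      exact (H.apply_one t).trans (hp t)
  | succ n ih =>
    intro f g q p hqp hp
    have : Nonempty Y := ⟨f (skelPt hx₀ _)⟩
    obtain ⟨q₁, hq₁, hpt⟩ := ih (q.map (res X Y n).continuous) p hqp hp
    obtain ⟨q', hq', hres⟩ := exists_path_lift_rel q hq₁
    refine ⟨q', hq', fun t => ?_⟩
    rw [← hres] at hpt
    exact hpt t

/-- A class of null-homotopies is represented by a pointed null-homotopy as soon as its trace at the
base point is trivial. -/
theorem exists_pointed_rep {n : ℕ} {f : C(skel X n, Y)} {y : Y} (hf : evalPt hx₀ Y n f = y)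
    (N : Path.Homotopic.Quotient f (cst X n y))
    (hN : mapQ (evalPt hx₀ Y n) hf (evalPt_cst hx₀ n y) N = Path.Homotopic.Quotient.refl y) :
    ∃ q : Path f (cst X n y), Path.Homotopic.Quotient.mk q = N ∧
      ∀ t, q t (skelPt hx₀ n) = y := by
  subst hf
  induction N using Path.Homotopic.Quotient.ind with | mk q =>
  obtain ⟨q', hq', h⟩ := exists_pointed_path hx₀ q (Path.refl (f (skelPt hx₀ n)))
    (Path.Homotopic.Quotient.exact hN) fun t => rfl
  exact ⟨q', Path.Homotopic.Quotient.eq.2 hq'.symm, h⟩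

/-- A freely null-homotopic map on a skeleton is pointed null-homotopic. -/
theorem exists_pointed_nullhomotopy {n : ℕ} {f : C(skel X n, Y)} {y : Y}
    (hf : evalPt hx₀ Y n f = y) (p : Path f (cst X n y)) :
    ∃ q : Path f (cst X n y), ∀ t, q t (skelPt hx₀ n) = y := by
  obtain ⟨q, -, hq⟩ := exists_pointed_rep hx₀ hf _
    (untrace_map_evalPt hx₀ hf (Path.Homotopic.Quotient.mk p))
  exact ⟨q, hq⟩

/-- If the tower of the groups `LoopGroup X y n` is Mittag-Leffler, then all phantom maps are
trivial: null-homotopies on the skeleta can be changed by elements of these groups so as to be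
compatible up to homotopy, then pointed, and then strictly compatible by path lifting. -/
theorem homotopicRel_const_of_mittagLeffler (hx₀ : x₀ ∈ skel X 0) {y : Y} (f : C(X, Y))
    (hfy : f x₀ = y) (hML : MittagLeffler (fun n => loopRes X y n))
    (hf : ∀ n, Nonempty (Path (f.restrict (skel X n)) (cst X n y))) :
    f.HomotopicRel (ContinuousMap.const X y) {x₀} := by
  have : Nonempty Y := ⟨y⟩
  let fn : ∀ n, C(skel X n, Y) := fun n => f.restrict (skel X n)
  have hfn : ∀ n, res X Y n (fn (n + 1)) = fn n := fun n => rfl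
  have hpt : ∀ n, evalPt hx₀ Y n (fn n) = y := fun n => hfy
  let e : ∀ n, Path.Homotopic.Quotient (fn n) (cst X n y) :=
    fun n => Path.Homotopic.Quotient.mk (hf n).some
  let e' : ∀ n, Path.Homotopic.Quotient (fn n) (cst X n y) :=
    fun n => mapQ (res X Y n) (hfn n) (res_cst n y) (e (n + 1))
  obtain ⟨h, hh⟩ := hML.exists_twisted_section (fun n => (e n).symm.trans (e' n))
  let h' : ∀ n, Path.Homotopic.Quotient (cst X n y) (cst X n y) := h
  have hh' : ∀ n, h' n = ((e n).symm.trans (e' n)).trans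
      (mapQ (res X Y n) (res_cst n y) (res_cst n y) (h' (n + 1))) := by
    intro n
    rw [← loopRes_apply]
    exact hh n
  -- the null-homotopies, corrected by `h'` and made pointed, are compatible up to homotopy
  let M : ∀ n, Path.Homotopic.Quotient (fn n) (cst X n y) :=
    fun n => untrace hx₀ (hpt n) ((e n).trans (h' n))
  have hM : ∀ n, mapQ (res X Y n) (hfn n) (res_cst n y) (M (n + 1)) = M n := by
    intro n
    simp only [M]
    rw [untrace_map_res hx₀ (hfn n) (hpt (n + 1)) (hpt n), mapQ_trans _ _ (res_cst n y), hh' n]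
    congr 1
    rw [← Path.Homotopic.Quotient.trans_assoc (e n), ← Path.Homotopic.Quotient.trans_assoc (e n),
      Path.Homotopic.Quotient.trans_symm, Path.Homotopic.Quotient.refl_trans]
  obtain ⟨q₀, hq₀, hq₀pt⟩ := exists_pointed_rep hx₀ (hpt 0) (M 0) (untrace_map_evalPt hx₀ _ _)
  have step : ∀ n (p : {p : Path (fn n) (cst X n y) // Path.Homotopic.Quotient.mk p = M n}),
      ∃ p' : {p : Path (fn (n + 1)) (cst X (n + 1) y) //
        Path.Homotopic.Quotient.mk p = M (n + 1)},
          mapPath (res X Y n) (hfn n) (res_cst n y) p'.1 = p.1 := by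
    rintro n ⟨p, hp⟩
    obtain ⟨q, hq⟩ := Path.Homotopic.Quotient.mk_surjective (M (n + 1))
    obtain ⟨q', hq', h⟩ := exists_path_lift_rel' (hfn n) (res_cst n y) q p
      (by rw [hp, hq, hM n])
    exact ⟨⟨q', hq'.trans hq⟩, h⟩
  choose next hnext using step
  let s : ∀ n, {p : Path (fn n) (cst X n y) // Path.Homotopic.Quotient.mk p = M n} :=
    fun n => Nat.rec ⟨q₀, hq₀⟩ (fun n p => next n p) n
  have hs : ∀ n t x, (s (n + 1)).1 t (skelIncl X n x) = (s n).1 t x := by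
    intro n t x
    have : mapPath (res X Y n) (hfn n) (res_cst n y) (s (n + 1)).1 = (s n).1 := hnext n (s n)
    rw [← this]
    rfl
  obtain ⟨F, hF⟩ := exists_glue_skel (Z := C(I, Y))
    (fun n => ContinuousMap.curry ⟨fun y : skel X n × I => (s n).1 y.2 y.1, by fun_prop⟩)
    (fun n x => by ext t; exact hs n t x)
  replace hF : ∀ n (x : skel X n) t, F x t = (s n).1 t x := fun n x t => by rw [hF]; rfl
  have hex : ∀ x : X, ∃ n, x ∈ skel X n :=
    fun x => mem_iUnion.1 (iUnion_skel (X := X) ▸ mem_univ x)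
  refine ⟨⟨⟨⟨fun y => F y.2 y.1, by fun_prop⟩, fun x => ?_, fun x => ?_⟩, ?_⟩⟩
  · obtain ⟨n, hn⟩ := hex x
    change F x 0 = f x
    rw [hF n ⟨x, hn⟩, (s n).1.source]
    rfl
  · obtain ⟨n, hn⟩ := hex x
    change F x 1 = y
    rw [hF n ⟨x, hn⟩, (s n).1.target]
    rfl
  · rintro t x rfl
    change F x t = f x
    rw [hF 0 ⟨x, hx₀⟩, hfy]
    exact hq₀pt t

/-- Every sequence of elements of the groups `LoopGroup X y n` is the sequence of differences of
null-homotopies on the skeleta of some map, built by path lifting. -/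
theorem exists_map_of_loops (hx₀ : x₀ ∈ skel X 0) {y : Y}
    (γ : ∀ n, Path (cst X n y) (cst X n y)) :
    ∃ (f : C(X, Y)) (N : ∀ n, Path (f.restrict (skel X n)) (cst X n y)),
      f x₀ = y ∧ ∀ n, mapPath (res X Y n) (res_restrict n f) (res_cst n y) (N (n + 1)) =
        (N n).trans (γ n) := by
  have : Nonempty Y := ⟨y⟩
  have step : ∀ n (s : Σ f : C(skel X n, Y), Path f (cst X n y)),
      ∃ s' : Σ f : C(skel X (n + 1), Y), Path f (cst X (n + 1) y),
        ∀ t, res X Y n (s'.2 t) = s.2.trans (γ n) t := by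
    rintro n ⟨f, N⟩
    obtain ⟨g, q, hq⟩ := exists_path_lift (cst X (n + 1) y) (n := n) (g := f)
      (N.trans (γ n)).symm
    refine ⟨⟨g, q.symm⟩, fun t => (hq _).trans ?_⟩
    change (N.trans (γ n)) (σ (σ t)) = _
    rw [symm_symm]
  choose next hnext using step
  let s : ∀ n, Σ f : C(skel X n, Y), Path f (cst X n y) :=
    fun n => Nat.rec ⟨cst X 0 y, Path.refl _⟩ (fun n p => next n p) n
  have hs : ∀ n t, res X Y n ((s (n + 1)).2 t) = (s n).2.trans (γ n) t :=
    fun n => hnext n (s n)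
  obtain ⟨f, hf⟩ := exists_glue_skel (fun n => (s n).1) fun n x => by
    have := congrArg (fun g => g x) (hs n 0)
    simp only [Path.source] at this
    exact this
  have hfn : ∀ n, f.restrict (skel X n) = (s n).1 := fun n => by ext x; exact hf n x
  refine ⟨f, fun n => (s n).2.cast (hfn n) rfl, hf 0 ⟨x₀, hx₀⟩, fun n => ?_⟩
  ext t x
  have := congrArg (fun g => g x) (hs n t)
  refine this.trans ?_
  rw [Path.trans_apply, Path.trans_apply]
  split_ifs <;> rfl

/-- If all phantom maps are trivial, then `lim¹` of the tower of the groups `LoopGroup X y n` is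
trivial. -/
theorem exists_twisted_section_of_phantom (hx₀ : x₀ ∈ skel X 0) {y : Y}
    (h : ∀ f : C(X, Y), f x₀ = y → (∀ n, ∃ q : Path (f.restrict (skel X n)) (cst X n y),
      ∀ t, q t (skelPt hx₀ n) = y) → f.Homotopic (ContinuousMap.const X y))
    (a : ∀ n, LoopGroup X y n) :
    ∃ x : ∀ n, LoopGroup X y n, ∀ n, x n = loopRes X y n (x (n + 1)) * a n := by
  choose γ hγ using fun n => Path.Homotopic.Quotient.mk_surjective
    (x₀ := cst X n y) (x₁ := cst X n y) (a n)
  obtain ⟨f, N, hfx, hN⟩ := exists_map_of_loops hx₀ γ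
  obtain ⟨F⟩ := h f hfx fun n => exists_pointed_nullhomotopy hx₀ hfx (N n)
  let P : ∀ n, Path (f.restrict (skel X n)) (cst X n y) := fun n =>
    { toContinuousMap := ContinuousMap.curry ⟨fun z : I × skel X n => F (z.1, z.2), by fun_prop⟩
      source' := by ext x; exact F.apply_zero x
      target' := by ext x; exact F.apply_one x }
  have hP : ∀ n, mapPath (res X Y n) (res_restrict n f) (res_cst n y) (P (n + 1)) = P n :=
    fun n => rfl
  -- the difference between the null-homotopy given by path lifting and the global one
  let x : ∀ n, Path.Homotopic.Quotient (cst X n y) (cst X n y) := fun n =>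
    (Path.Homotopic.Quotient.mk (N n)).symm.trans (Path.Homotopic.Quotient.mk (P n))
  have hx : ∀ n, x n = (Path.Homotopic.Quotient.mk (γ n)).trans
      (mapQ (res X Y n) (res_cst n y) (res_cst n y) (x (n + 1))) := by
    intro n
    simp only [x]
    rw [mapQ_trans _ _ (res_restrict n f), mapQ_symm _ (res_restrict n f), mapQ_mk, mapQ_mk, hN, hP,
      Path.Homotopic.Quotient.mk_trans]
    exact symm_trans_eq _ _ _
  refine ⟨x, fun n => ?_⟩
  rw [FundamentalGroup.mul_def, ← hγ n, loopRes_apply]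
  exact hx n

end

/-! ### Nearby maps into a finite CW complex are homotopic -/

/-- A subset `S` of a space such that every map from a compact Hausdorff space to `S` is homotopic
in `S` to all nearby maps to `S`. -/
def LocHomotopic.{w, v} {Y : Type v} [TopologicalSpace Y] (S : Set Y) : Prop :=
  ∀ (W : Type w) [TopologicalSpace W] [CompactSpace W] [T2Space W] (f : C(W, Y)), (∀ x, f x ∈ S) →
    ∀ᶠ g in 𝓝 f, (∀ x, g x ∈ S) → ∃ F : f.Homotopy g, ∀ y, F y ∈ S

/-- The map `Φ` from the unit ball of `E` exhibits `Y` as the space obtained from its closed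
subset `S` by attaching a cell, and `Ψ` is the inverse of `Φ` on the open cell. The values of `Φ`
outside the ball and of `Ψ` on `S` are irrelevant. -/
structure IsCellAttachment {E Y : Type*} [NormedAddCommGroup E] [TopologicalSpace Y]
    (S : Set Y) (Φ : E → Y) (Ψ : Y → E) : Prop where
  isClosed : IsClosed S
  continuousOn : ContinuousOn Φ (closedBall 0 1)
  continuousOn_inv : ContinuousOn Ψ Sᶜ
  mem_of_sphere : ∀ v ∈ sphere (0 : E) 1, Φ v ∈ S
  notMem_of_ball : ∀ v ∈ ball (0 : E) 1, Φ v ∉ S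
  left_inv : ∀ v ∈ ball (0 : E) 1, Ψ (Φ v) = v
  mem_ball : ∀ y ∉ S, Ψ y ∈ ball (0 : E) 1
  right_inv : ∀ y ∉ S, Φ (Ψ y) = y

namespace IsCellAttachment

open Classical in
/-- The radial coordinate, equal to `1` outside the open cell. -/
noncomputable def radius {E Y : Type*} [NormedAddCommGroup E] (S : Set Y) (Ψ : Y → E) (y : Y) : ℝ :=
  if y ∈ S then 1 else ‖Ψ y‖

/-- The radial stretching of the unit ball, from the identity at `t = 0` to the map at `t = 1` which
doubles the norm, truncated at norm `1`. -/
noncomputable def stretch {E : Type*} [NormedAddCommGroup E] [NormedSpace ℝ E] (t : ℝ) (v : E) :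
    E :=
  ((1 + t) / max 1 ((1 + t) * ‖v‖)) • v

open Classical in
/-- The homotopy of self-maps of `Y` induced by the stretching of the cell. -/
noncomputable def push {E Y : Type*} [NormedAddCommGroup E] [NormedSpace ℝ E] (S : Set Y)
    (Φ : E → Y) (Ψ : Y → E) (t : ℝ) (y : Y) : Y :=
  if y ∈ S then y else Φ (stretch t (Ψ y))

section

variable {E : Type*} [NormedAddCommGroup E] [NormedSpace ℝ E]

theorem continuous_stretch : Continuous fun y : ℝ × E => stretch y.1 y.2 := by
  refine Continuous.smul (Continuous.div (by fun_prop) (by fun_prop) fun y => ?_) (by fun_prop)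
  exact (lt_of_lt_of_le one_pos (le_max_left _ _)).ne'

theorem norm_stretch {t : ℝ} (ht : 0 ≤ t) (v : E) :
    ‖stretch t v‖ = (1 + t) * ‖v‖ / max 1 ((1 + t) * ‖v‖) := by
  have h : 0 ≤ (1 + t) / max 1 ((1 + t) * ‖v‖) :=
    div_nonneg (by linarith) (le_trans zero_le_one (le_max_left _ _))
  rw [stretch, norm_smul, Real.norm_of_nonneg h]
  ring

theorem norm_stretch_le {t : ℝ} (ht : 0 ≤ t) (v : E) : ‖stretch t v‖ ≤ 1 := by
  rw [norm_stretch ht, div_le_one (lt_of_lt_of_le one_pos (le_max_left _ _))]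
  exact le_max_right _ _

theorem norm_stretch_one {v : E} (hv : 1 / 2 ≤ ‖v‖) : ‖stretch 1 v‖ = 1 := by
  rw [norm_stretch zero_le_one, max_eq_right (by linarith), div_self (by linarith)]

theorem stretch_zero {v : E} (hv : ‖v‖ ≤ 1) : stretch 0 v = v := by
  rw [stretch, max_eq_left (by linarith)]
  simp

theorem stretch_of_norm {t : ℝ} (ht : 0 ≤ t) {v : E} (hv : ‖v‖ = 1) : stretch t v = v := by
  rw [stretch, hv, mul_one, max_eq_right (by linarith), div_self (by linarith), one_smul]

end

variable {E Y : Type*} [NormedAddCommGroup E] [NormedSpace ℝ E] [ProperSpace E]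
  [TopologicalSpace Y] [T2Space Y] {S : Set Y} {Φ : E → Y} {Ψ : Y → E}

section

variable (h : IsCellAttachment S Φ Ψ)
include h

theorem union_eq : S ∪ Φ '' closedBall 0 1 = univ := by
  refine eq_univ_of_forall fun y => ?_
  by_cases hy : y ∈ S
  · exact Or.inl hy
  · exact Or.inr ⟨Ψ y, ball_subset_closedBall (h.mem_ball y hy), h.right_inv y hy⟩

theorem isClosed_image : IsClosed (Φ '' closedBall 0 1) :=
  ((isCompact_closedBall 0 1).image_of_continuousOn h.continuousOn).isClosed

theorem radius_apply {v : E} (hv : v ∈ closedBall (0 : E) 1) : radius S Ψ (Φ v) = ‖v‖ := by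
  rw [← sphere_union_ball] at hv
  rcases hv with hv | hv
  · rw [radius, if_pos (h.mem_of_sphere v hv), mem_sphere_zero_iff_norm.1 hv]
  · rw [radius, if_neg (h.notMem_of_ball v hv), h.left_inv v hv]

theorem push_apply {t : ℝ} (ht : 0 ≤ t) {v : E} (hv : v ∈ closedBall (0 : E) 1) :
    push S Φ Ψ t (Φ v) = Φ (stretch t v) := by
  rw [← sphere_union_ball] at hv
  rcases hv with hv | hv
  · rw [push, if_pos (h.mem_of_sphere v hv), stretch_of_norm ht (mem_sphere_zero_iff_norm.1 hv)]
  · rw [push, if_neg (h.notMem_of_ball v hv), h.left_inv v hv]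

theorem continuous_radius : Continuous (radius S Ψ) := by
  rw [← continuousOn_univ, ← h.union_eq]
  refine ContinuousOn.union_of_isClosed ?_ ?_ h.isClosed h.isClosed_image
  · exact continuousOn_const.congr fun y hy => if_pos hy
  · refine continuousOn_image_of_comp (isCompact_closedBall 0 1) h.continuousOn ?_
    exact continuous_norm.continuousOn.congr fun v hv => h.radius_apply hv

theorem continuous_push : Continuous fun y : I × Y => push S Φ Ψ y.1 y.2 := by
  have hu : (univ : Set I) ×ˢ S ∪ (univ : Set I) ×ˢ (Φ '' closedBall 0 1) = univ := by
    rw [← prod_union, h.union_eq, univ_prod_univ]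
  rw [← continuousOn_univ, ← hu]
  refine ContinuousOn.union_of_isClosed ?_ ?_ (isClosed_univ.prod h.isClosed)
    (isClosed_univ.prod h.isClosed_image)
  · exact continuousOn_snd.congr fun y hy => if_pos hy.2
  · have hK : (univ : Set I) ×ˢ (Φ '' closedBall 0 1) =
        (Prod.map id Φ) '' ((univ : Set I) ×ˢ closedBall (0 : E) 1) := by
      rw [prodMap_image_prod, image_id]
    rw [hK]
    refine continuousOn_image_of_comp (isCompact_univ.prod (isCompact_closedBall 0 1))
      (continuousOn_id.prodMap h.continuousOn) ?_
    have : ContinuousOn (fun y : I × E => Φ (stretch y.1 y.2)) (univ ×ˢ closedBall 0 1) := by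
      refine h.continuousOn.comp (Continuous.continuousOn ?_) fun y _ => ?_
      · exact continuous_stretch.comp
          (f := fun y : I × E => ((y.1 : ℝ), y.2)) (by fun_prop)
      · exact mem_closedBall_zero_iff.2 (norm_stretch_le y.1.2.1 _)
    exact this.congr fun y hy => h.push_apply y.1.2.1 hy.2

theorem push_zero (y : Y) : push S Φ Ψ 0 y = y := by
  rw [push]
  split_ifs with hy
  · rfl
  · rw [stretch_zero (mem_closedBall_zero_iff.1 (ball_subset_closedBall (h.mem_ball y hy))),
      h.right_inv y hy]

theorem push_one_mem {y : Y} (hy : 1 / 2 ≤ radius S Ψ y) : push S Φ Ψ 1 y ∈ S := by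
  rw [push]
  split_ifs with hyS
  · exact hyS
  · rw [radius, if_neg hyS] at hy
    exact h.mem_of_sphere _ (mem_sphere_zero_iff_norm.2 (norm_stretch_one hy))

theorem notMem_of_radius {y : Y} (hy : radius S Ψ y < 1) : y ∉ S := by
  intro hyS
  rw [radius, if_pos hyS] at hy
  exact lt_irrefl _ hy

omit h in
theorem radius_of_notMem {y : Y} (hy : y ∉ S) : radius S Ψ y = ‖Ψ y‖ := if_neg hy

end

/-- The point with parameter `s` on the straight line from `y` to `z` in the open cell. -/
def line (Φ : E → Y) (Ψ : Y → E) (s : ℝ) (y z : Y) : Y := Φ ((1 - s) • Ψ y + s • Ψ z)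

section

variable (h : IsCellAttachment S Φ Ψ)
include h

theorem line_zero {y : Y} (z : Y) (hy : y ∉ S) : line Φ Ψ 0 y z = y := by
  simp [line, h.right_inv y hy]

theorem line_one (y : Y) {z : Y} (hz : z ∉ S) : line Φ Ψ 1 y z = z := by
  simp [line, h.right_inv z hz]

theorem convex_mem_ball {s : ℝ} (hs : s ∈ I) {y z : Y} (hy : y ∉ S) (hz : z ∉ S) :
    (1 - s) • Ψ y + s • Ψ z ∈ ball (0 : E) 1 :=
  convex_ball (0 : E) 1 (h.mem_ball y hy) (h.mem_ball z hz) (by linarith [hs.2]) hs.1 (by ring)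

theorem continuousOn_line : ContinuousOn (fun x : I × Y × Y => line Φ Ψ x.1 x.2.1 x.2.2)
    (univ ×ˢ (Sᶜ ×ˢ Sᶜ)) := by
  refine h.continuousOn.comp ?_
    fun x hx => ball_subset_closedBall (h.convex_mem_ball x.1.2 hx.2.1 hx.2.2)
  have h1 : ContinuousOn (fun x : I × Y × Y => Ψ x.2.1) (univ ×ˢ (Sᶜ ×ˢ Sᶜ)) :=
    h.continuousOn_inv.comp (by fun_prop) fun x hx => hx.2.1
  have h2 : ContinuousOn (fun x : I × Y × Y => Ψ x.2.2) (univ ×ˢ (Sᶜ ×ˢ Sᶜ)) :=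
    h.continuousOn_inv.comp (by fun_prop) fun x hx => hx.2.2
  exact ContinuousOn.add (ContinuousOn.smul (by fun_prop) h1) (ContinuousOn.smul (by fun_prop) h2)

theorem radius_line {s : ℝ} (hs : s ∈ I) {y z : Y} (hy : y ∉ S) (hz : z ∉ S)
    (hyr : 5 / 8 ≤ radius S Ψ y) (hyz : ‖Ψ z - Ψ y‖ < 1 / 8) :
    1 / 2 ≤ radius S Ψ (line Φ Ψ s y z) := by
  rw [line, h.radius_apply (ball_subset_closedBall (h.convex_mem_ball hs hy hz))]
  rw [radius_of_notMem hy] at hyr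
  have e : (1 - s) • Ψ y + s • Ψ z = Ψ y + s • (Ψ z - Ψ y) := by
    rw [smul_sub, sub_smul, one_smul]; abel
  have h1 : ‖s • (Ψ z - Ψ y)‖ ≤ 1 / 8 := by
    rw [norm_smul, Real.norm_of_nonneg hs.1]
    nlinarith [hs.2, hs.1, norm_nonneg (Ψ z - Ψ y)]
  have h2 := norm_sub_le_norm_add (Ψ y) (s • (Ψ z - Ψ y))
  rw [e]
  linarith

end

/-- The part of the cylinder `I × W` over which a homotopy between `f` and a nearby map is deformed
into the smaller space: the two ends over the region `5 / 8 ≤ radius`, and the collar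
`5 / 8 ≤ radius ≤ 3 / 4`. -/
def collar {W : Type*} (S : Set Y) (Ψ : Y → E) (f : W → Y) : Set (I × W) :=
  {x | 5 / 8 ≤ radius S Ψ (f x.2) ∧ (x.1 = 0 ∨ x.1 = 1 ∨ radius S Ψ (f x.2) ≤ 3 / 4)}

open Classical in
/-- The map on the collar which is `f` and `g` at the ends and the straight line homotopy in
between. -/
noncomputable def collarMap {W : Type*} (Φ : E → Y) (Ψ : Y → E) (f g : W → Y) (x : I × W) : Y :=
  if x.1 = 0 then f x.2 else if x.1 = 1 then g x.2 else line Φ Ψ x.1 (f x.2) (g x.2)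

variable {W : Type*} [TopologicalSpace W] [CompactSpace W] [T2Space W]

/-- The maps close enough to `f` for the straight line homotopy on the collar to make sense. -/
def nearby (S : Set Y) (Ψ : Y → E) (f : C(W, Y)) : Set C(W, Y) :=
  {g | ∀ w, radius S Ψ (f w) ≤ 3 / 4 → g w ∉ S ∧ ‖Ψ (g w) - Ψ (f w)‖ < 1 / 8}

variable (h : IsCellAttachment S Φ Ψ)
include h

theorem nearby_mem_nhds (f : C(W, Y)) : nearby S Ψ f ∈ 𝓝 f := by
  have hK : IsCompact {w | radius S Ψ (f w) ≤ 3 / 4} :=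
    (isClosed_le (h.continuous_radius.comp f.continuous) continuous_const).isCompact
  let U : Set (Y × Y) := (Sᶜ ×ˢ Sᶜ) ∩ (fun y : Y × Y => ‖Ψ y.1 - Ψ y.2‖) ⁻¹' Iio (1 / 8)
  have hS : IsOpen (Sᶜ ×ˢ Sᶜ : Set (Y × Y)) := h.isClosed.isOpen_compl.prod h.isClosed.isOpen_compl
  have hU : IsOpen U := by
    refine ContinuousOn.isOpen_inter_preimage ?_ hS isOpen_Iio
    exact ((h.continuousOn_inv.comp continuousOn_fst fun x hx => hx.1).sub
      (h.continuousOn_inv.comp continuousOn_snd fun x hx => hx.2)).norm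
  have hcont : Continuous fun g : C(W, Y) => g.prodMk f := by
    refine ContinuousMap.continuous_of_continuous_uncurry _ ?_
    exact (ContinuousEval.continuous_eval).prodMk (f.continuous.comp continuous_snd)
  have hopen := (ContinuousMap.isOpen_setOfPred_mapsTo hK hU).preimage hcont
  have hfS : ∀ w, radius S Ψ (f w) ≤ 3 / 4 → f w ∉ S :=
    fun w hw => h.notMem_of_radius (by linarith)
  refine Filter.mem_of_superset (hopen.mem_nhds ?_) ?_
  · intro w hw
    refine ⟨⟨hfS w hw, hfS w hw⟩, ?_⟩
    simp
  · intro g hg w hw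
    exact ⟨(hg hw).1.1, (hg hw).2⟩

theorem isClosed_collar (f : C(W, Y)) : IsClosed (collar S Ψ f) := by
  have hr : Continuous fun x : I × W => radius S Ψ (f x.2) :=
    h.continuous_radius.comp (f.continuous.comp continuous_snd)
  refine (isClosed_le continuous_const hr).inter ?_
  refine (isClosed_eq continuous_fst continuous_const).union ?_
  exact (isClosed_eq continuous_fst continuous_const).union (isClosed_le hr continuous_const)

theorem collarMap_eq_line {f : C(W, Y)} {g : C(W, Y)} (hg : g ∈ nearby S Ψ f) {x : I × W}
    (hx : radius S Ψ (f x.2) ≤ 3 / 4) :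
    collarMap Φ Ψ f g x = line Φ Ψ x.1 (f x.2) (g x.2) := by
  have hf : f x.2 ∉ S := h.notMem_of_radius (by linarith)
  rw [collarMap]
  split_ifs with h0 h1
  · rw [h0, Icc.coe_zero, h.line_zero _ hf]
  · rw [h1, Icc.coe_one, h.line_one _ (hg _ hx).1]
  · rfl

/-- The collar maps depend continuously on `g`. -/
theorem continuous_collarMap (f : C(W, Y)) :
    Continuous fun x : nearby S Ψ f × collar S Ψ f => collarMap Φ Ψ f x.1.1 x.2.1 := by
  have hr : Continuous fun x : nearby S Ψ f × collar S Ψ f => radius S Ψ (f x.2.1.2) :=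
    h.continuous_radius.comp (f.continuous.comp (by fun_prop))
  have hev : Continuous fun x : nearby S Ψ f × collar S Ψ f => x.1.1 x.2.1.2 := by fun_prop
  have hs : Continuous fun x : nearby S Ψ f × collar S Ψ f => x.2.1.1 := by fun_prop
  have hu : ({x | x.2.1.1 = 0} ∪ ({x | x.2.1.1 = 1} ∪ {x | radius S Ψ (f x.2.1.2) ≤ 3 / 4}) :
      Set (nearby S Ψ f × collar S Ψ f)) = univ :=
    eq_univ_of_forall fun x => x.2.2.2
  have c0 : IsClosed {x : nearby S Ψ f × collar S Ψ f | x.2.1.1 = 0} :=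
    isClosed_eq hs continuous_const
  have c1 : IsClosed {x : nearby S Ψ f × collar S Ψ f | x.2.1.1 = 1} :=
    isClosed_eq hs continuous_const
  have c2 : IsClosed {x : nearby S Ψ f × collar S Ψ f | radius S Ψ (f x.2.1.2) ≤ 3 / 4} :=
    isClosed_le hr continuous_const
  rw [← continuousOn_univ, ← hu]
  refine ContinuousOn.union_of_isClosed ?_ (ContinuousOn.union_of_isClosed ?_ ?_ c1 c2) c0
    (c1.union c2)
  · have : Continuous fun x : nearby S Ψ f × collar S Ψ f => f x.2.1.2 := by fun_prop
    refine this.continuousOn.congr fun x hx => ?_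
    have hx0 : x.2.1.1 = 0 := hx
    rw [collarMap, if_pos hx0]
  · refine hev.continuousOn.congr fun x hx => ?_
    have hx1 : x.2.1.1 = 1 := hx
    rw [collarMap, if_neg (by rw [hx1]; exact one_ne_zero), if_pos hx1]
  · refine (h.continuousOn_line.comp (f := fun x : nearby S Ψ f × collar S Ψ f =>
      (x.2.1.1, f x.2.1.2, x.1.1 x.2.1.2)) (Continuous.continuousOn ?_) fun x hx => ?_).congr
      fun x hx => h.collarMap_eq_line x.1.2 hx
    · fun_prop
    · exact ⟨trivial, h.notMem_of_radius (lt_of_le_of_lt hx (by norm_num)), (x.1.2 _ hx).1⟩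

theorem half_le_radius_collarMap {f g : C(W, Y)} (hg : g ∈ nearby S Ψ f)
    (hgr : ∀ w, 5 / 8 ≤ radius S Ψ (f w) → 1 / 2 ≤ radius S Ψ (g w)) {x : I × W}
    (hx : x ∈ collar S Ψ f) : 1 / 2 ≤ radius S Ψ (collarMap Φ Ψ f g x) := by
  by_cases hx3 : radius S Ψ (f x.2) ≤ 3 / 4
  · rw [h.collarMap_eq_line hg hx3]
    have hf : f x.2 ∉ S := h.notMem_of_radius (by linarith)
    exact h.radius_line x.1.2 hf (hg _ hx3).1 hx.1 (hg _ hx3).2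
  · rcases hx.2 with h0 | h1 | h2
    · rw [collarMap, if_pos h0]
      linarith [hx.1]
    · rw [collarMap, if_neg (by rw [h1]; exact one_ne_zero), if_pos h1]
      exact hgr _ hx.1
    · exact absurd h2 hx3

/-- The passage from a homotopy over the collar to a homotopy of maps. Here `T` deforms the collar
map, and `τ` is a cut-off function which turns the deformation on across the collar. The resulting
map on the cylinder is a homotopy between maps homotopic to `f` and `g`. -/
theorem homotopic_of_collar_homotopy {f g : C(W, Y)} (hg : g ∈ nearby S Ψ f)
    (T : C(I × collar S Ψ f, Y)) (k : C(W, Y))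
    (hT₀ : ∀ x, T (0, x) = collarMap Φ Ψ f g x) (hT₁ : ∀ x, T (1, x) = k x.1.2) :
    f.Homotopic g := by
  classical
  by_cases hW : Nonempty W
  swap
  · rw [not_nonempty_iff] at hW
    exact ⟨ContinuousMap.Homotopy.refl f |>.cast rfl (by ext x; exact hW.elim x)⟩
  obtain ⟨w₀⟩ := hW
  have : Nonempty Y := ⟨f w₀⟩
  let r : W → ℝ := fun w => radius S Ψ (f w)
  have hr : Continuous r := h.continuous_radius.comp f.continuous
  let τ : W → I := fun w => projIcc 0 1 zero_le_one (8 * (r w - 5 / 8))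
  have hτ : Continuous τ := continuous_projIcc.comp (by fun_prop)
  have hτ₀ : ∀ w, r w ≤ 5 / 8 → τ w = 0 := fun w hw =>
    projIcc_of_le_left _ (by linarith)
  have hτ₁ : ∀ w, 3 / 4 ≤ r w → τ w = 1 := fun w hw =>
    projIcc_of_right_le _ (by linarith)
  obtain ⟨T', hT', hTT'⟩ := exists_continuousOn_extend (s := (univ : Set I) ×ˢ collar S Ψ f)
    (T.comp ⟨fun x => (x.1.1, ⟨x.1.2, x.2.2⟩), by fun_prop⟩)
  replace hTT' : ∀ t x (hx : x ∈ collar S Ψ f), T' (t, x) = T (t, ⟨x, hx⟩) :=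
    fun t x hx => hTT' ⟨(t, x), trivial, hx⟩
  let G : I × W → Y := fun x => if r x.2 ≤ 5 / 8 then line Φ Ψ x.1 (f x.2) (g x.2)
    else if r x.2 ≤ 3 / 4 then T' (τ x.2, x) else k x.2
  have hr2 : Continuous fun x : I × W => r x.2 := hr.comp continuous_snd
  have hG : Continuous G := by
    rw [← continuousOn_univ]
    refine continuousOn_ite_le (u := fun x : I × W => r x.2) (v := fun _ => 5 / 8)
      hr2.continuousOn continuousOn_const ?_
      (continuousOn_ite_le (u := fun x : I × W => r x.2) (v := fun _ => 3 / 4)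
        hr2.continuousOn continuousOn_const ?_ ?_ ?_) ?_
    · refine h.continuousOn_line.comp (f := fun x : I × W => (x.1, f x.2, g x.2))
        (Continuous.continuousOn (by fun_prop)) fun x hx => ?_
      have hx' : radius S Ψ (f x.2) ≤ 5 / 8 := hx.2
      exact ⟨trivial, h.notMem_of_radius (by linarith), (hg _ (by linarith)).1⟩
    · refine hT'.comp (Continuous.continuousOn ?_)
        fun x hx => ⟨trivial, hx.1.2, Or.inr (Or.inr hx.2)⟩
      exact (hτ.comp continuous_snd).prodMk continuous_id
    · exact (k.continuous.comp continuous_snd).continuousOn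
    · intro x hx hx3
      rw [hτ₁ _ hx3.ge, hTT' _ _ ⟨hx.2, Or.inr (Or.inr hx3.le)⟩, hT₁]
    · intro x _ hx
      have hx3 : r x.2 ≤ 3 / 4 := by linarith
      rw [if_pos hx3, hτ₀ _ hx.le, hTT' _ _ ⟨hx.ge, Or.inr (Or.inr hx3)⟩, hT₀,
        h.collarMap_eq_line hg hx3]
  -- `G` is a homotopy between `g' 0` and `g' 1`, and these are homotopic to `f` and `g` by turning
  -- off the deformation `T` at the two ends
  let g' : I → C(W, Y) := fun s => ⟨fun w => G (s, w), by fun_prop⟩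
  have key : ∀ (s : I) (f' : C(W, Y)), (s = 0 ∨ s = 1) →
      (∀ w, collarMap Φ Ψ f g (s, w) = f' w) → f'.Homotopic (g' s) := by
    intro s f' hs hf'
    have hmem : ∀ w, 5 / 8 ≤ r w → (s, w) ∈ collar S Ψ f := fun w hw =>
      ⟨hw, by rcases hs with hs | hs <;> simp [hs]⟩
    let H : I × W → Y := fun x =>
      if r x.2 ≤ 5 / 8 then f' x.2 else T' (x.1 * τ x.2, (s, x.2))
    have hH : Continuous H := by
      rw [← continuousOn_univ]
      refine continuousOn_ite_le (u := fun x : I × W => r x.2) (v := fun _ => 5 / 8)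
        hr2.continuousOn continuousOn_const ?_ ?_ ?_
      · exact (f'.continuous.comp continuous_snd).continuousOn
      · refine hT'.comp (Continuous.continuousOn ?_) fun x hx => ⟨trivial, hmem _ hx.2⟩
        exact (continuous_fst.mul (hτ.comp continuous_snd)).prodMk (by fun_prop)
      · intro x _ hx
        rw [hτ₀ _ hx.le, mul_zero, hTT' _ _ (hmem _ hx.ge), hT₀, hf']
    refine ⟨⟨⟨H, hH⟩, fun w => ?_, fun w => ?_⟩⟩
    · change H (0, w) = f' w
      simp only [H]
      split_ifs with hw
      · rfl
      · rw [zero_mul, hTT' _ _ (hmem _ (not_le.1 hw).le), hT₀, hf']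
    · change H (1, w) = G (s, w)
      simp only [H, G, one_mul]
      split_ifs with hw hw3
      · have hw3 : radius S Ψ (f w) ≤ 3 / 4 := by
          have : radius S Ψ (f w) ≤ 5 / 8 := hw
          linarith
        rw [← hf', h.collarMap_eq_line hg hw3]
      · rfl
      · rw [hτ₁ _ (not_le.1 hw3).le, hTT' _ _ (hmem _ (not_le.1 hw).le), hT₁]
  have h0 : f.Homotopic (g' 0) := key 0 f (Or.inl rfl) fun w => by simp [collarMap]
  have h1 : g.Homotopic (g' 1) := key 1 g (Or.inr rfl) fun w => by simp [collarMap]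
  have h01 : (g' 0).Homotopic (g' 1) := ⟨⟨⟨G, hG⟩, fun w => rfl, fun w => rfl⟩⟩
  exact (h0.trans h01).trans h1.symm

end IsCellAttachment

/-- Attaching a cell preserves the property `LocHomotopic`. Away from the center of the cell the
maps can be pushed into the smaller space. Applying the hypothesis to the ends of the cylinder and
the collar simultaneously makes the resulting homotopy compatible with the straight line homotopy
near the center. -/
theorem IsCellAttachment.eventually_homotopic.{w, v} {E : Type*} {Y : Type v}
    [NormedAddCommGroup E] [NormedSpace ℝ E] [ProperSpace E] [TopologicalSpace Y] [T2Space Y]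
    {S : Set Y} {Φ : E → Y} {Ψ : Y → E} (h : IsCellAttachment S Φ Ψ) (hS : LocHomotopic.{w} S)
    {W : Type w} [TopologicalSpace W] [CompactSpace W] [T2Space W] (f : C(W, Y)) :
    ∀ᶠ g in 𝓝 f, f.Homotopic g := by
  have hcc : CompactSpace (collar S Ψ f) :=
    isCompact_iff_compactSpace.1 (h.isClosed_collar f).isCompact
  -- the closed set where `g` has to stay away from the center of the cell
  have hfar : {g : C(W, Y) | ∀ w, 5 / 8 ≤ radius S Ψ (f w) → 1 / 2 ≤ radius S Ψ (g w)} ∈ 𝓝 f := by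
    have hK : IsCompact {w | 5 / 8 ≤ radius S Ψ (f w)} :=
      (isClosed_le continuous_const (h.continuous_radius.comp f.continuous)).isCompact
    have hU : IsOpen {y | 1 / 2 < radius S Ψ y} := isOpen_lt continuous_const h.continuous_radius
    refine Filter.mem_of_superset ((ContinuousMap.isOpen_setOfPred_mapsTo hK hU).mem_nhds ?_) ?_
    · intro w hw
      have hw' : 5 / 8 ≤ radius S Ψ (f w) := hw
      change 1 / 2 < radius S Ψ (f w)
      linarith
    · intro g hg w hw
      exact (hg hw).le
  have hpush : Continuous (push S Φ Ψ 1) := by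
    have := h.continuous_push.comp (f := fun y : Y => ((1 : I), y)) (by fun_prop)
    exact this
  -- the collar map pushed into `S`; it depends continuously on `g`, so `hS` applies
  let κ : C(nearby S Ψ f, C(collar S Ψ f, Y)) :=
    ContinuousMap.curry ⟨_, hpush.comp (h.continuous_collarMap f)⟩
  have hκ : ∀ g x, κ g x = push S Φ Ψ 1 (collarMap Φ Ψ f g.1 x) := fun _ _ => rfl
  let k : C(W, Y) := ⟨fun w => push S Φ Ψ 1 (f w), hpush.comp f.continuous⟩
  let kc : C(collar S Ψ f, Y) := ⟨fun x => k x.1.2, by fun_prop⟩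
  have hkc : ∀ x, kc x ∈ S := fun x => h.push_one_mem (le_trans (by norm_num) x.2.1)
  have hff : f ∈ nearby S Ψ f := mem_of_mem_nhds (h.nearby_mem_nhds f)
  have hκf : κ ⟨f, hff⟩ = kc := by
    ext x
    rw [hκ]
    change _ = push S Φ Ψ 1 (f x.1.2)
    congr 1
    by_cases hx3 : radius S Ψ (f x.1.2) ≤ 3 / 4
    · rw [h.collarMap_eq_line hff hx3, line, ← add_smul, sub_add_cancel, one_smul,
        h.right_inv _ (h.notMem_of_radius (by linarith))]
    · rcases x.2.2 with h0 | h1 | h2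
      · rw [collarMap, if_pos h0]
      · rw [collarMap, if_neg (by rw [h1]; exact one_ne_zero), if_pos h1]
      · exact absurd h2 hx3
  have hev := hS (collar S Ψ f) kc hkc
  rw [← hκf] at hev
  have hev' := κ.continuous.continuousAt.eventually hev
  rw [nhds_subtype_eq_comap, eventually_comap] at hev'
  filter_upwards [hev', h.nearby_mem_nhds f, hfar] with g hg hgn hgf
  obtain ⟨Θ, -⟩ := hg ⟨g, hgn⟩ rfl fun x => h.push_one_mem (h.half_le_radius_collarMap hgn hgf x.2)
  let A : I × collar S Ψ f → Y := fun x => push S Φ Ψ x.1 (collarMap Φ Ψ f g x.2)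
  have hcol : Continuous fun x : collar S Ψ f => collarMap Φ Ψ f g x :=
    (h.continuous_collarMap f).comp (f := fun x => ((⟨g, hgn⟩ : nearby S Ψ f), x)) (by fun_prop)
  have hA : Continuous A :=
    h.continuous_push.comp (continuous_fst.prodMk (hcol.comp continuous_snd))
  let A' : ContinuousMap.Homotopy (⟨_, hcol⟩ : C(collar S Ψ f, Y)) (κ ⟨g, hgn⟩) :=
    ⟨⟨A, hA⟩, fun x => h.push_zero _, fun x => rfl⟩
  let T := A'.trans Θ.symm
  refine h.homotopic_of_collar_homotopy hgn T.toContinuousMap k (fun x => ?_) fun x => ?_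
  · exact T.apply_zero x
  · refine (T.apply_one x).trans ?_
    rw [hκf]
    rfl

/-! ### Finite subcomplexes -/

/-- A Hausdorff continuous image of a compact second countable space is second countable: the
complements of the images of complements of finite unions of basic open sets form a basis. -/
theorem secondCountableTopology_of_surjective {K Z : Type*} [TopologicalSpace K] [CompactSpace K]
    [SecondCountableTopology K] [TopologicalSpace Z] [T2Space Z] {p : K → Z} (hp : Continuous p)
    (hs : Function.Surjective p) : SecondCountableTopology Z := by
  obtain ⟨b, hbc, -, hb⟩ := TopologicalSpace.exists_countable_basis K
  have hopen : ∀ F : Set (Set K), F ⊆ b → IsOpen (p '' (⋃₀ F)ᶜ)ᶜ := fun F hF =>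
    ((isOpen_sUnion fun u hu => hb.isOpen (hF hu)).isClosed_compl.isCompact.image
      hp).isClosed.isOpen_compl
  refine (TopologicalSpace.IsTopologicalBasis.secondCountableTopology
    (b := (fun F : Set (Set K) => (p '' (⋃₀ F)ᶜ)ᶜ) '' {F | F.Finite ∧ F ⊆ b}) ?_
    ((countable_ofPred_finite_subset hbc).image _))
  refine TopologicalSpace.isTopologicalBasis_of_isOpen_of_nhds ?_ ?_
  · rintro _ ⟨F, hF, rfl⟩
    exact hopen F hF.2
  · intro z u hzu hu
    have hK : IsCompact (p ⁻¹' {z}) := (isClosed_singleton.preimage hp).isCompact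
    have hcov : ∀ x ∈ p ⁻¹' {z}, ∃ v ∈ b, x ∈ v ∧ v ⊆ p ⁻¹' u := fun x hx =>
      hb.exists_subset_of_mem_open (by rw [mem_preimage, (hx : p x = z)]; exact hzu)
        (hu.preimage hp)
    obtain ⟨F, hF, hFf, hFc⟩ := hK.elim_finite_subcover_image (b := {v ∈ b | v ⊆ p ⁻¹' u}) (c := id)
      (fun v hv => hb.isOpen hv.1) fun x hx => by
        obtain ⟨v, hv, hxv, hvu⟩ := hcov x hx
        exact mem_biUnion (⟨hv, hvu⟩ : v ∈ {v ∈ b | v ⊆ p ⁻¹' u}) hxv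
    refine ⟨_, ⟨F, ⟨hFf, fun v hv => (hF hv).1⟩, rfl⟩, ?_, ?_⟩
    · rintro ⟨x, hx, hxz⟩
      obtain ⟨v, hv, hxv⟩ := mem_iUnion₂.1 (hFc hxz)
      exact hx ⟨v, hv, hxv⟩
    · intro z' hz'
      obtain ⟨x, rfl⟩ := hs z'
      by_contra hxu
      refine hz' ⟨x, ?_, rfl⟩
      rintro ⟨v, hv, hxv⟩
      exact hxu ((hF hv).2 hxv)

section

variable {Y : Type*} [TopologicalSpace Y] [T2Space Y] [CWComplex (univ : Set Y)]

/-- The finite subcomplexes of a CW complex, generated from the empty set by attaching cells one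
at a time. -/
inductive IsFiniteSubcomplex : Set Y → Prop
  | empty : IsFiniteSubcomplex ∅
  | attach {S : Set Y} (n : ℕ) (e : RelCWComplex.cell (univ : Set Y) n) :
      IsFiniteSubcomplex S → RelCWComplex.cellFrontier n e ⊆ S →
      Disjoint (RelCWComplex.openCell n e) S → IsFiniteSubcomplex (S ∪ RelCWComplex.closedCell n e)

namespace IsFiniteSubcomplex

variable {S : Set Y}

theorem isCompact (h : IsFiniteSubcomplex S) : IsCompact S := by
  induction h with
  | empty => exact isCompact_empty
  | attach n e _ _ _ ih => exact ih.union CWComplex.isCompact_closedCell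

/-- Each cell of the CW complex either belongs to the finite subcomplex or is disjoint from it. -/
theorem closedCell_subset_or_disjoint (h : IsFiniteSubcomplex S) (n : ℕ)
    (e : RelCWComplex.cell (univ : Set Y) n) :
    RelCWComplex.closedCell n e ⊆ S ∨ Disjoint (RelCWComplex.openCell n e) S := by
  induction h with
  | empty => exact Or.inr (disjoint_empty _)
  | @attach S m e' _ hf _ ih =>
    rcases ih with ih | ih
    · exact Or.inl (ih.trans subset_union_left)
    · by_cases he : (⟨n, e⟩ : Σ n, RelCWComplex.cell (univ : Set Y) n) = ⟨m, e'⟩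
      · cases he
        exact Or.inl subset_union_right
      · refine Or.inr ?_
        rw [← CWComplex.cellFrontier_union_openCell_eq_closedCell, ← union_assoc,
          union_eq_self_of_subset_right hf]
        exact ih.union_right (CWComplex.disjoint_openCell_of_ne he)

theorem exists_finset_superset {F : Finset (Σ n, RelCWComplex.cell (univ : Set Y) n)}
    (hF : ∀ e ∈ F, ∀ S : Set Y, IsFiniteSubcomplex S →
      ∃ S', IsFiniteSubcomplex S' ∧ S ⊆ S' ∧ RelCWComplex.closedCell e.1 e.2 ⊆ S')
    (h : IsFiniteSubcomplex S) : ∃ S', IsFiniteSubcomplex S' ∧ S ⊆ S' ∧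
      ∀ e ∈ F, RelCWComplex.closedCell e.1 e.2 ⊆ S' := by
  classical
  induction F using Finset.induction_on with
  | empty => exact ⟨S, h, Subset.rfl, by simp⟩
  | insert e F _ ih =>
    obtain ⟨S₁, h₁, hS₁, hF₁⟩ := ih fun e he => hF e (Finset.mem_insert_of_mem he)
    obtain ⟨S₂, h₂, hS₂, hF₂⟩ := hF e (Finset.mem_insert_self _ _) S₁ h₁
    refine ⟨S₂, h₂, hS₁.trans hS₂, fun e' he' => ?_⟩
    rcases Finset.mem_insert.1 he' with rfl | he'
    · exact hF₂
    · exact (hF₁ e' he').trans hS₂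

/-- Every finite subcomplex can be enlarged so as to contain a given cell, by first adding the
finitely many cells of lower dimension which meet the boundary of the cell. -/
theorem exists_superset (n : ℕ) (e : RelCWComplex.cell (univ : Set Y) n) :
    ∀ S : Set Y, IsFiniteSubcomplex S →
      ∃ S', IsFiniteSubcomplex S' ∧ S ⊆ S' ∧ RelCWComplex.closedCell n e ⊆ S' := by
  induction n using Nat.strong_induction_on with
  | _ n ih =>
    intro S h
    obtain ⟨J, hJ⟩ := CWComplex.cellFrontier_subset_finite_closedCell n e
    obtain ⟨S₁, h₁, hS₁, hF₁⟩ := exists_finset_superset (F := (Finset.range n).sigma J)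
      (fun e' he' => ih e'.1 (Finset.mem_range.1 (Finset.mem_sigma.1 he').1) e'.2) h
    have hf : RelCWComplex.cellFrontier n e ⊆ S₁ := by
      refine hJ.trans (iUnion₂_subset fun m hm => iUnion₂_subset fun j hj => ?_)
      exact hF₁ ⟨m, j⟩ (Finset.mem_sigma.2 ⟨Finset.mem_range.2 hm, hj⟩)
    rcases h₁.closedCell_subset_or_disjoint n e with he | he
    · exact ⟨S₁, h₁, hS₁, he⟩
    · exact ⟨_, h₁.attach n e hf he, hS₁.trans subset_union_left, subset_union_right⟩

theorem secondCountableTopology (h : IsFiniteSubcomplex S) : SecondCountableTopology S := by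
  induction h with
  | empty => infer_instance
  | @attach S n e h _ _ ih =>
    have : CompactSpace S := isCompact_iff_compactSpace.1 h.isCompact
    have : CompactSpace (closedBall (0 : Fin n → ℝ) 1) :=
      isCompact_iff_compactSpace.1 (isCompact_closedBall 0 1)
    let p : S ⊕ closedBall (0 : Fin n → ℝ) 1 → (S ∪ RelCWComplex.closedCell n e : Set Y) :=
      Sum.elim (fun x => ⟨x, Or.inl x.2⟩) fun v => ⟨RelCWComplex.map n e v, Or.inr ⟨v, v.2, rfl⟩⟩
    refine secondCountableTopology_of_surjective (p := p) ?_ ?_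
    · refine continuous_sum_dom.2 ⟨Continuous.subtype_mk continuous_subtype_val _, Continuous.subtype_mk ?_ _⟩
      exact (RelCWComplex.continuousOn n e).domRestrict
    · rintro ⟨x, hx | ⟨v, hv, rfl⟩⟩
      · exact ⟨Sum.inl ⟨x, hx⟩, rfl⟩
      · exact ⟨Sum.inr ⟨v, hv⟩, rfl⟩

end IsFiniteSubcomplex

/-- A CW complex of finite type has second countable skeleta. -/
theorem secondCountableTopology_skel [CWComplex.FiniteType (univ : Set Y)] (n : ℕ) :
    SecondCountableTopology (skel Y n) := by
  have key : ∀ n, ∃ S, IsFiniteSubcomplex S ∧ skel Y n ⊆ S := by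
    intro n
    have hadd : ∀ n, ∀ S : Set Y, IsFiniteSubcomplex S →
        ∃ S', IsFiniteSubcomplex S' ∧ S ⊆ S' ∧
          ∀ e : RelCWComplex.cell (univ : Set Y) n, RelCWComplex.closedCell n e ⊆ S' := by
      intro n S h
      have := Fintype.ofFinite (RelCWComplex.cell (univ : Set Y) n)
      obtain ⟨S', h', hS', hF⟩ := IsFiniteSubcomplex.exists_finset_superset
        (F := Finset.univ.map (Function.Embedding.sigmaMk n))
        (fun e _ => IsFiniteSubcomplex.exists_superset e.1 e.2) h
      exact ⟨S', h', hS', fun e => hF ⟨n, e⟩ (Finset.mem_map.2 ⟨e, Finset.mem_univ _, rfl⟩)⟩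
    induction n with
    | zero =>
      obtain ⟨S, h, -, hS⟩ := hadd 0 ∅ .empty
      refine ⟨S, h, ?_⟩
      rw [skel_zero]
      exact iUnion_subset hS
    | succ n ih =>
      obtain ⟨S, h, hS⟩ := ih
      obtain ⟨S', h', hS', hF⟩ := hadd (n + 1) S h
      refine ⟨S', h', ?_⟩
      rw [skel_succ]
      exact union_subset (hS.trans hS') (iUnion_subset hF)
  obtain ⟨S, h, hS⟩ := key n
  have := h.secondCountableTopology
  exact (IsEmbedding.inclusion hS).secondCountableTopology

/-- A countable CW complex is exhausted by an increasing sequence of finite subcomplexes, in such a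
way that each compact subset lies in one of them. -/
theorem exists_exhaustion [CountableCW Y] [Nonempty Y] :
    ∃ S : ℕ → Set Y, (∀ j, IsFiniteSubcomplex (S j)) ∧ ∀ C, IsCompact C → ∃ j, C ⊆ S j := by
  have hun : ∀ y : Y, ∃ e : Σ n, RelCWComplex.cell (univ : Set Y) n,
      y ∈ RelCWComplex.closedCell e.1 e.2 := by
    intro y
    have hy : y ∈ ⋃ (n : ℕ) (j : RelCWComplex.cell (univ : Set Y) n),
        RelCWComplex.closedCell n j := by
      rw [CWComplex.union]
      exact mem_univ y
    obtain ⟨n, hn⟩ := mem_iUnion.1 hy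
    obtain ⟨e, he⟩ := mem_iUnion.1 hn
    exact ⟨⟨n, e⟩, he⟩
  have : Countable (Σ n, RelCWComplex.cell (univ : Set Y) n) := CountableCW.countable_cells
  have : Nonempty (Σ n, RelCWComplex.cell (univ : Set Y) n) :=
    ⟨(hun (Classical.arbitrary Y)).choose⟩
  obtain ⟨c, hc⟩ := exists_surjective_nat (Σ n, RelCWComplex.cell (univ : Set Y) n)
  choose! ext hext hsub hcell using
    fun (j : ℕ) (S : Set Y) => IsFiniteSubcomplex.exists_superset (c j).1 (c j).2 S
  let S : ℕ → Set Y := fun j => j.rec ∅ ext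
  have hS : ∀ j, IsFiniteSubcomplex (S j) := by
    intro j
    induction j with
    | zero => exact .empty
    | succ j ih => exact hext j _ ih
  have hmono : Monotone S := monotone_nat_of_le_succ fun j => hsub j _ (hS j)
  have hcS : ∀ e : Σ n, RelCWComplex.cell (univ : Set Y) n,
      ∃ j, RelCWComplex.closedCell e.1 e.2 ⊆ S j := by
    intro e
    obtain ⟨j, rfl⟩ := hc e
    exact ⟨j + 1, hcell j _ (hS j)⟩
  refine ⟨S, hS, fun C hC => ?_⟩
  by_contra! hnot
  choose x hxC hxS using fun j => not_subset.1 (hnot j)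
  -- the points `x k` with `j ≤ k` form a closed set, as only finitely many lie in a given cell
  have hclosed : ∀ j, IsClosed (x '' Ici j) := by
    intro j
    rw [CWComplex.closed (univ : Set Y) _ (subset_univ _)]
    intro n e
    obtain ⟨m, hm⟩ := hcS ⟨n, e⟩
    refine (Finite.subset ((finite_Iio m).image x) ?_).isClosed
    rintro _ ⟨⟨k, -, rfl⟩, hk⟩
    refine ⟨k, not_le.1 fun hmk => hxS k (hmono hmk (hm hk)), rfl⟩
  obtain ⟨z, hz⟩ := IsCompact.nonempty_iInter_of_sequence_nonempty_isCompact_isClosed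
    (fun j => x '' Ici j) (fun j => image_mono (Ici_subset_Ici.2 j.le_succ))
    (fun j => ⟨x j, j, self_mem_Ici, rfl⟩)
    (hC.of_isClosed_subset (hclosed 0) (by rintro _ ⟨k, -, rfl⟩; exact hxC k)) hclosed
  obtain ⟨e, he⟩ := hun z
  obtain ⟨m, hm⟩ := hcS e
  obtain ⟨k, hk, hkz⟩ := mem_iInter.1 hz m
  exact hxS k (hmono hk (hkz ▸ hm he))

end

/-! ### Nearby maps into a finite subcomplex -/

section

variable {Y : Type*} [TopologicalSpace Y] {S S' : Set Y}

theorem locHomotopic_empty.{w} : LocHomotopic.{w} (∅ : Set Y) := by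
  intro W _ _ _ f hf
  refine Eventually.of_forall fun g hg => ?_
  have : IsEmpty W := ⟨fun x => hf x⟩
  exact ⟨(ContinuousMap.Homotopy.refl f).cast rfl (by ext x; exact this.elim x),
    fun y => this.elim y.2⟩

/-- The property `LocHomotopic` is intrinsic to the subspace. -/
theorem LocHomotopic.preimage_val.{w} (h : LocHomotopic.{w} S) (hS : S ⊆ S') :
    LocHomotopic.{w} ((↑) ⁻¹' S : Set S') := by
  intro W _ _ _ f hf
  let ι : C(S', Y) := ⟨(↑), continuous_subtype_val⟩
  have hev := h W (ι.comp f) hf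
  filter_upwards [(ContinuousMap.continuous_postcomp ι).continuousAt.eventually hev] with g hg hgS
  obtain ⟨F, hF⟩ := hg hgS
  exact ⟨⟨⟨fun y => ⟨F y, hS (hF y)⟩, by fun_prop⟩, fun x => Subtype.ext (F.apply_zero x),
    fun x => Subtype.ext (F.apply_one x)⟩, hF⟩

theorem locHomotopic_of_subtype.{w}
    (h : ∀ (W : Type w) [TopologicalSpace W] [CompactSpace W] [T2Space W] (f : C(W, S)),
      ∀ᶠ g in 𝓝 f, f.Homotopic g) : LocHomotopic.{w} S := by
  intro W _ _ _ f hf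
  let ι : C(S, Y) := ⟨(↑), continuous_subtype_val⟩
  let f' : C(W, S) := ⟨fun x => ⟨f x, hf x⟩, by fun_prop⟩
  have hev := h W f'
  rw [(ContinuousMap.isInducing_postcomp ι IsInducing.subtypeVal).nhds_eq_comap,
    eventually_comap] at hev
  have hf' : ι.comp f' = f := rfl
  rw [hf'] at hev
  filter_upwards [hev] with g hg hgS
  obtain ⟨F⟩ := hg ⟨fun x => ⟨g x, hgS x⟩, by fun_prop⟩ rfl
  refine ⟨⟨⟨fun y => F y, by fun_prop⟩, fun x => ?_, fun x => ?_⟩, fun y => (F y).2⟩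
  · exact congrArg Subtype.val (F.apply_zero x)
  · exact congrArg Subtype.val (F.apply_one x)

variable [T2Space Y] [CWComplex (univ : Set Y)]

open Classical in
/-- The characteristic map of a cell, as a map into a subspace containing the closed cell. Outside
the unit ball it is constant. -/
noncomputable def cellMap {n : ℕ} (e : RelCWComplex.cell (univ : Set Y) n)
    (hS : RelCWComplex.closedCell n e ⊆ S) (v : Fin n → ℝ) : S :=
  if hv : v ∈ closedBall (0 : Fin n → ℝ) 1 then ⟨RelCWComplex.map n e v, hS ⟨v, hv, rfl⟩⟩
  else ⟨RelCWComplex.map n e 0, hS ⟨0, by simp, rfl⟩⟩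

theorem cellMap_coe {n : ℕ} (e : RelCWComplex.cell (univ : Set Y) n)
    (hS : RelCWComplex.closedCell n e ⊆ S) {v : Fin n → ℝ} (hv : v ∈ closedBall (0 : Fin n → ℝ) 1) :
    (cellMap e hS v : Y) = RelCWComplex.map n e v := by
  rw [cellMap, dif_pos hv]

theorem isCellAttachment_cellMap {n : ℕ} (e : RelCWComplex.cell (univ : Set Y) n)
    (hcl : IsClosed S) (hf : RelCWComplex.cellFrontier n e ⊆ S)
    (hd : Disjoint (RelCWComplex.openCell n e) S) :
    IsCellAttachment ((↑) ⁻¹' S : Set (S ∪ RelCWComplex.closedCell n e : Set Y))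
      (cellMap e subset_union_right) fun y => (RelCWComplex.map n e).symm y := by
  have hsub : ball (0 : Fin n → ℝ) 1 ⊆ closedBall 0 1 := ball_subset_closedBall
  have hsrc : (RelCWComplex.map n e).source = ball 0 1 := RelCWComplex.source_eq n e
  have htgt : (RelCWComplex.map n e).target = RelCWComplex.openCell n e := by
    rw [← PartialEquiv.image_source_eq_target, hsrc]
    rfl
  have hopen : ∀ y : (S ∪ RelCWComplex.closedCell n e : Set Y), (y : Y) ∉ S →
      (y : Y) ∈ (RelCWComplex.map n e).target := by
    intro y hy
    rcases y.2 with h | h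
    · exact absurd h hy
    · rw [htgt]
      exact ((CWComplex.cellFrontier_union_openCell_eq_closedCell n e).superset h).resolve_left
        fun h => hy (hf h)
  have hball : ∀ y : (S ∪ RelCWComplex.closedCell n e : Set Y), (y : Y) ∉ S →
      (RelCWComplex.map n e).symm y ∈ ball (0 : Fin n → ℝ) 1 := fun y hy => by
    rw [← hsrc]
    exact (RelCWComplex.map n e).map_target (hopen y hy)
  refine ⟨hcl.preimage continuous_subtype_val, ?_, ?_, ?_, ?_, ?_, hball, ?_⟩
  · rw [IsInducing.subtypeVal.continuousOn_iff]
    exact (RelCWComplex.continuousOn n e).congr fun v hv => cellMap_coe e _ hv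
  · exact (RelCWComplex.continuousOn_symm n e).comp continuous_subtype_val.continuousOn hopen
  · intro v hv
    rw [mem_preimage, cellMap_coe e _ (sphere_subset_closedBall hv)]
    exact hf ⟨v, hv, rfl⟩
  · intro v hv
    rw [mem_preimage, cellMap_coe e _ (hsub hv)]
    exact disjoint_left.1 hd ⟨v, hv, rfl⟩
  · intro v hv
    rw [cellMap_coe e _ (hsub hv)]
    exact (RelCWComplex.map n e).left_inv (hsrc ▸ hv)
  · intro y hy
    refine Subtype.ext ?_
    rw [cellMap_coe e _ (hsub (hball y hy))]
    exact (RelCWComplex.map n e).right_inv (hopen y hy)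

theorem IsFiniteSubcomplex.locHomotopic.{w} (h : IsFiniteSubcomplex S) : LocHomotopic.{w} S := by
  induction h with
  | empty => exact locHomotopic_empty
  | attach n e h hf hd ih =>
    exact locHomotopic_of_subtype fun W _ _ _ f =>
      (isCellAttachment_cellMap e h.isCompact.isClosed hf hd).eventually_homotopic
        (ih.preimage_val subset_union_left) f

end

/-! ### Countability of the fundamental groups of mapping spaces -/

section

variable {Z : Type*} [TopologicalSpace Z] {a b c d : Z}

/-- A map from the square gives a relation between the paths along its sides. -/
theorem trans_eq_trans_of_square (Q : C(I × I, Z)) (p : Path a b) (q : Path b d) (r : Path a c)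
    (s : Path c d) (hp : ∀ t, Q (t, 0) = p t) (hq : ∀ t, Q (1, t) = q t)
    (hr : ∀ t, Q (0, t) = r t) (hs : ∀ t, Q (t, 1) = s t) :
    (Path.Homotopic.Quotient.mk p).trans (Path.Homotopic.Quotient.mk q) =
      (Path.Homotopic.Quotient.mk r).trans (Path.Homotopic.Quotient.mk s) := by
  have : ContractibleSpace I := (convex_Icc (0 : ℝ) 1).contractibleSpace ⟨0, by simp⟩
  let p' : Path ((0 : I), (0 : I)) (1, 0) := ⟨⟨fun t => (t, 0), by fun_prop⟩, rfl, rfl⟩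
  let q' : Path ((1 : I), (0 : I)) (1, 1) := ⟨⟨fun t => (1, t), by fun_prop⟩, rfl, rfl⟩
  let r' : Path ((0 : I), (0 : I)) (0, 1) := ⟨⟨fun t => (0, t), by fun_prop⟩, rfl, rfl⟩
  let s' : Path ((0 : I), (1 : I)) (1, 1) := ⟨⟨fun t => (t, 1), by fun_prop⟩, rfl, rfl⟩
  have ha : Q (0, 0) = a := by rw [hp, p.source]
  have hb : Q (1, 0) = b := by rw [hp, p.target]
  have hc : Q (0, 1) = c := by rw [hr, r.target]
  have hd : Q (1, 1) = d := by rw [hq, q.target]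
  have ep : mapPath Q ha hb p' = p := Path.ext (funext hp)
  have eq : mapPath Q hb hd q' = q := Path.ext (funext hq)
  have er : mapPath Q ha hc r' = r := Path.ext (funext hr)
  have es : mapPath Q hc hd s' = s := Path.ext (funext hs)
  rw [← ep, ← eq, ← er, ← es, ← mapQ_mk, ← mapQ_mk, ← mapQ_mk, ← mapQ_mk, ← mapQ_trans,
    ← mapQ_trans]
  exact congrArg _ (Subsingleton.elim _ _)

end

section

variable {K Y : Type*} [TopologicalSpace K] [TopologicalSpace Y] (S : Set Y) (y : Y)

/-- The loops in `C(K, Y)` at the constant map `y` whose values are maps into `S`, regarded as a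
space of maps from `I × K` to `S`. -/
abbrev LoopsIn (K : Type*) [TopologicalSpace K] : Type _ :=
  {a : C(I × K, S) // ∀ k, (a (0, k) : Y) = y ∧ (a (1, k) : Y) = y}

variable {S y}

/-- The path underlying an element of `LoopsIn S y K`. -/
def LoopsIn.toPath (a : LoopsIn S y K) :
    Path (ContinuousMap.const K y) (ContinuousMap.const K y) where
  toContinuousMap := ContinuousMap.curry ⟨fun x => (a.1 x : Y), by fun_prop⟩
  source' := by ext k; exact (a.2 k).1
  target' := by ext k; exact (a.2 k).2

/-- Nearby loops are homotopic as loops. Let `W` be the product of `K` with the boundary of the square.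
The map on `W` given by `a` on both horizontal sides is close to the one given by `a` on the bottom
and by `b` on the top, with the constant loop on the vertical sides in both cases. The traces of a
free homotopy between them at the four corners are loops, with equal classes `δ` at the left and `δ'`
at the right corners, and comparison along the horizontal sides shows that both `a` and `b` are
homotopic to `δ⁻¹ a δ'`. -/
theorem LocHomotopic.eventually_toPath_eq.{w, v} {K : Type w} [TopologicalSpace K] [CompactSpace K]
    [T2Space K] {Y : Type v} [TopologicalSpace Y] {S : Set Y} {y : Y} (h : LocHomotopic.{w} S)
    (a : LoopsIn S y K) :
    ∀ᶠ b in 𝓝 a, Path.Homotopic.Quotient.mk b.toPath = Path.Homotopic.Quotient.mk a.toPath := by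
  let B : Set (I × I) := {p | (p.2 = 0 ∨ p.2 = 1) ∨ p.1 = 0 ∨ p.1 = 1}
  have hB : IsClosed B := by
    refine IsClosed.union (IsClosed.union ?_ ?_) (IsClosed.union ?_ ?_) <;>
    exact isClosed_eq (by fun_prop) (by fun_prop)
  have : CompactSpace B := isCompact_iff_compactSpace.1 hB.isCompact
  let G : LoopsIn S y K × (B × K) → Y := fun x =>
    if (x.2.1.1.2 : ℝ) ≤ 1 / 2 then a.1 (x.2.1.1.1, x.2.2) else x.1.1 (x.2.1.1.1, x.2.2)
  have hG : Continuous G := by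
    refine Continuous.if_le (by fun_prop) (by fun_prop) (by fun_prop) continuous_const ?_
    rintro ⟨b, ⟨⟨s, t⟩, hst⟩, k⟩ (hx : (t : ℝ) = 1 / 2)
    rcases hst with (ht | ht) | hs | hs
    · have ht : t = 0 := ht
      norm_num [ht] at hx
    · have ht : t = 1 := ht
      norm_num [ht] at hx
    · have hs : s = 0 := hs
      simp only [hs, (a.2 k).1, (b.2 k).1]
    · have hs : s = 1 := hs
      simp only [hs, (a.2 k).2, (b.2 k).2]
  let κ : C(LoopsIn S y K, C(B × K, Y)) := ContinuousMap.curry ⟨G, hG⟩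
  have hκ : ∀ b x, κ b x = if (x.1.1.2 : ℝ) ≤ 1 / 2 then (a.1 (x.1.1.1, x.2) : Y)
    else b.1 (x.1.1.1, x.2) := fun _ _ => rfl
  have hκS : ∀ b x, κ b x ∈ S := by
    intro b x
    rw [hκ]
    split_ifs
    · exact Subtype.coe_prop _
    · exact Subtype.coe_prop _
  have hκa : ∀ x, κ a x = a.1 (x.1.1.1, x.2) := fun x => by rw [hκ, ite_self]
  have hev := κ.continuous.continuousAt.eventually (h (B × K) (κ a) (hκS a))
  filter_upwards [hev] with b hb
  obtain ⟨H, -⟩ := hb (hκS b)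
  have h0 : ∀ p k, H (0, p, k) = a.1 (p.1.1, k) := fun p k => (H.apply_zero _).trans (hκa _)
  have h1 : ∀ p k, p.1.2 = 0 → H (1, p, k) = a.1 (p.1.1, k) := fun p k hp => by
    rw [H.apply_one, hκ, if_pos (by simp [hp])]
  have h1' : ∀ p k, p.1.2 = 1 → H (1, p, k) = b.1 (p.1.1, k) := fun p k hp => by
    rw [H.apply_one, hκ, if_neg (by norm_num [hp])]
  have h1l : ∀ p k, p.1.1 = 0 → H (1, p, k) = y := fun p k hp => by
    rw [H.apply_one, hκ]
    simp only [hp, (a.2 k).1, (b.2 k).1, ite_self]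
  have h1r : ∀ p k, p.1.1 = 1 → H (1, p, k) = y := fun p k hp => by
    rw [H.apply_one, hκ]
    simp only [hp, (a.2 k).2, (b.2 k).2, ite_self]
  -- the trace of the homotopy at a point of one of the vertical sides
  let δ : ∀ p : B, p.1.1 = 0 ∨ p.1.1 = 1 →
      Path (ContinuousMap.const K y) (ContinuousMap.const K y) := fun p hp =>
    { toContinuousMap := ContinuousMap.curry ⟨fun x : I × K => H (x.1, p, x.2), by fun_prop⟩
      source' := by
        ext k
        refine (h0 p k).trans ?_
        rcases hp with hp | hp
        · rw [hp, (a.2 k).1]; rfl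
        · rw [hp, (a.2 k).2]; rfl
      target' := by
        ext k
        rcases hp with hp | hp
        · exact h1l p k hp
        · exact h1r p k hp }
  -- the homotopy along one of the sides, as a map from the square
  let Q : C(I, B) → C(I × I, C(K, Y)) := fun γ =>
    ContinuousMap.curry ⟨fun x : (I × I) × K => H (x.1.2, γ x.1.1, x.2), by fun_prop⟩
  have hbot := trans_eq_trans_of_square (Q ⟨fun t => ⟨(t, 0), Or.inl (Or.inl rfl)⟩, by fun_prop⟩)
    a.toPath (δ ⟨(1, 0), Or.inr (Or.inr rfl)⟩ (Or.inr rfl))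
    (δ ⟨(0, 0), Or.inr (Or.inl rfl)⟩ (Or.inl rfl)) a.toPath
    (fun t => ContinuousMap.ext fun k => h0 _ _) (fun t => rfl) (fun t => rfl)
    (fun t => ContinuousMap.ext fun k => h1 _ _ rfl)
  have htop := trans_eq_trans_of_square (Q ⟨fun t => ⟨(t, 1), Or.inl (Or.inr rfl)⟩, by fun_prop⟩)
    a.toPath (δ ⟨(1, 1), Or.inr (Or.inr rfl)⟩ (Or.inr rfl))
    (δ ⟨(0, 1), Or.inr (Or.inl rfl)⟩ (Or.inl rfl)) b.toPath
    (fun t => ContinuousMap.ext fun k => h0 _ _) (fun t => rfl) (fun t => rfl)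
    (fun t => ContinuousMap.ext fun k => h1' _ _ rfl)
  have hleft := trans_eq_trans_of_square (Q ⟨fun t => ⟨(0, t), Or.inr (Or.inl rfl)⟩, by fun_prop⟩)
    (Path.refl _) (δ ⟨(0, 1), Or.inr (Or.inl rfl)⟩ (Or.inl rfl))
    (δ ⟨(0, 0), Or.inr (Or.inl rfl)⟩ (Or.inl rfl)) (Path.refl _)
    (fun t => ContinuousMap.ext fun k => (h0 _ _).trans (a.2 k).1) (fun t => rfl) (fun t => rfl)
    (fun t => ContinuousMap.ext fun k => h1l _ _ rfl)
  have hright := trans_eq_trans_of_square (Q ⟨fun t => ⟨(1, t), Or.inr (Or.inr rfl)⟩, by fun_prop⟩)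
    (Path.refl _) (δ ⟨(1, 1), Or.inr (Or.inr rfl)⟩ (Or.inr rfl))
    (δ ⟨(1, 0), Or.inr (Or.inr rfl)⟩ (Or.inr rfl)) (Path.refl _)
    (fun t => ContinuousMap.ext fun k => (h0 _ _).trans (a.2 k).2) (fun t => rfl) (fun t => rfl)
    (fun t => ContinuousMap.ext fun k => h1r _ _ rfl)
  rw [Path.Homotopic.Quotient.mk_refl, Path.Homotopic.Quotient.refl_trans,
    Path.Homotopic.Quotient.trans_refl] at hleft hright
  rw [hleft, hright, hbot] at htop
  have := congrArg (fun g => (Path.Homotopic.Quotient.mk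
    (δ ⟨(0, 0), Or.inr (Or.inl rfl)⟩ (Or.inl rfl))).symm.trans g) htop
  simpa only [← Path.Homotopic.Quotient.trans_assoc, Path.Homotopic.Quotient.symm_trans,
    Path.Homotopic.Quotient.refl_trans] using this.symm

end

/-- The fundamental group of the space of maps from a compact second countable space to a countable
CW complex is countable. -/
theorem countable_homotopicQuotient.{w, v} (K : Type w) [TopologicalSpace K] [CompactSpace K]
    [T2Space K] [SecondCountableTopology K] {Y : Type v} [TopologicalSpace Y] [T2Space Y]
    [CWComplex (univ : Set Y)] [CountableCW Y] (y : Y) :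
    Countable (Path.Homotopic.Quotient (ContinuousMap.const K y) (ContinuousMap.const K y)) := by
  have : Nonempty Y := ⟨y⟩
  obtain ⟨S, hS, hC⟩ := exists_exhaustion (Y := Y)
  have hcount : ∀ j, (range fun a : LoopsIn (S j) y K =>
      Path.Homotopic.Quotient.mk a.toPath).Countable := by
    intro j
    have := (hS j).secondCountableTopology
    have : SecondCountableTopology C(I × K, S j) := inferInstance
    have : SecondCountableTopology (LoopsIn (S j) y K) :=
      TopologicalSpace.Subtype.secondCountableTopology _
    obtain ⟨D, hD, hDd⟩ := TopologicalSpace.exists_countable_dense (LoopsIn (S j) y K)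
    refine (hD.image fun a => Path.Homotopic.Quotient.mk a.toPath).mono ?_
    rintro _ ⟨a, rfl⟩
    obtain ⟨V, hV, hVo, haV⟩ := eventually_nhds_iff.1 ((hS j).locHomotopic.eventually_toPath_eq a)
    obtain ⟨b, hbD, hbV⟩ := hDd.exists_mem_open hVo ⟨a, haV⟩
    exact ⟨b, hbD, hV b hbV⟩
  refine countable_univ_iff.1 ((countable_iUnion hcount).mono fun g _ => ?_)
  induction g using Path.Homotopic.Quotient.ind with | mk p =>
  have hp : Continuous fun x : I × K => p x.1 x.2 := by fun_prop
  obtain ⟨j, hj⟩ := hC _ (isCompact_range hp)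
  refine mem_iUnion.2 ⟨j, ⟨⟨⟨fun x => ⟨p x.1 x.2, hj ⟨x, rfl⟩⟩, by fun_prop⟩, fun k => ?_⟩, rfl⟩⟩
  change p 0 k = y ∧ p 1 k = y
  rw [p.source, p.target]
  exact ⟨rfl, rfl⟩

theorem countable_loopGroup {X : Type*} [TopologicalSpace X] [T2Space X] [CWComplex (univ : Set X)]
    [CWComplex.FiniteType (univ : Set X)] {Y : Type*} [TopologicalSpace Y] [T2Space Y]
    [CWComplex (univ : Set Y)] [CountableCW Y] (y : Y) (n : ℕ) : Countable (LoopGroup X y n) := by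
  have := secondCountableTopology_skel (Y := X) n
  exact countable_homotopicQuotient (skel X n) y

/-! ### Homotopy invariance of the tower as a tower of sets -/

section

variable (K : Type*) [TopologicalSpace K] [LocallyCompactSpace K] {Y : Type*} [TopologicalSpace Y] (y : Y)

/-- Free homotopy of continuous maps. -/
def homotopySetoid (K L : Type*) [TopologicalSpace K] [TopologicalSpace L] : Setoid C(K, L) :=
  ⟨ContinuousMap.Homotopic, ContinuousMap.Homotopic.equivalence⟩

/-- A map into the loop space is a loop in the mapping space at the constant map. -/
def loopTranspose : C(K, LoopSpace Y y) ≃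
    Path (ContinuousMap.const K y) (ContinuousMap.const K y) where
  toFun f :=
    { toContinuousMap := ContinuousMap.curry
        ⟨fun x : I × K => (f x.2 : Path y y) x.1,
          (Path.continuous_uncurry_iff.2 f.continuous).comp continuous_swap⟩
      source' := by ext k; exact (f k : Path y y).source
      target' := by ext k; exact (f k : Path y y).target }
  invFun p :=
    { toFun := fun k => (⟨⟨fun t => p t k, by fun_prop⟩, by simp, by simp⟩ : Path y y)
      continuous_toFun := by
        refine Path.continuous_uncurry_iff.1 ?_
        change Continuous fun x : K × I => p x.2 x.1
        fun_prop }
  left_inv f := rfl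
  right_inv p := rfl

variable {K y}

theorem homotopic_loopTranspose_iff (f g : C(K, LoopSpace Y y)) :
    f.Homotopic g ↔ (loopTranspose K y f).Homotopic (loopTranspose K y g) := by
  constructor
  · rintro ⟨F⟩
    have hF : Continuous fun x : (I × I) × K => (F (x.1.1, x.2) : Path y y) x.1.2 :=
      (Path.continuous_uncurry_iff.2 F.continuous).comp
        (f := fun x : (I × I) × K => ((x.1.1, x.2), x.1.2)) (by fun_prop)
    refine ⟨⟨⟨ContinuousMap.curry ⟨_, hF⟩, fun t => ?_, fun t => ?_⟩, fun s t ht => ?_⟩⟩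
    · ext k
      exact congrArg (fun p : Path y y => p t) (F.apply_zero k)
    · ext k
      exact congrArg (fun p : Path y y => p t) (F.apply_one k)
    · ext k
      rcases ht with rfl | rfl
      · exact (F (s, k) : Path y y).source.trans (f k : Path y y).source.symm
      · exact (F (s, k) : Path y y).target.trans (f k : Path y y).target.symm
  · rintro ⟨H⟩
    have h0 : ∀ s k, H (s, 0) k = y := fun s k =>
      congrArg (fun φ : C(K, Y) => φ k) ((H.eq_fst s (Or.inl rfl)).trans (Path.source _))
    have h1 : ∀ s k, H (s, 1) k = y := fun s k =>
      congrArg (fun φ : C(K, Y) => φ k) ((H.eq_fst s (Or.inr rfl)).trans (Path.target _))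
    let F : I × K → LoopSpace Y y := fun x =>
      (⟨⟨fun t => H (x.1, t) x.2, by fun_prop⟩, h0 _ _, h1 _ _⟩ : Path y y)
    have hF : Continuous F := by
      refine Path.continuous_uncurry_iff.1 ?_
      change Continuous fun x : (I × K) × I => H (x.1.1, x.2) x.1.2
      fun_prop
    refine ⟨⟨⟨F, hF⟩, fun k => Path.ext (funext fun t => ?_),
      fun k => Path.ext (funext fun t => ?_)⟩⟩
    · exact congrArg (fun φ : C(K, Y) => φ k) (H.apply_zero t)
    · exact congrArg (fun φ : C(K, Y) => φ k) (H.apply_one t)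

variable (K y) in
/-- Free homotopy classes of maps into the loop space are, as a set, the fundamental group of the
mapping space. -/
noncomputable def loopClassesEquiv : Quotient (homotopySetoid K (LoopSpace Y y)) ≃
    Path.Homotopic.Quotient (ContinuousMap.const K y) (ContinuousMap.const K y) :=
  Quotient.congr (loopTranspose K y) homotopic_loopTranspose_iff

end

section

variable {K : Type*} [TopologicalSpace K]

/-- The map on free homotopy classes given by precomposition. -/
def homotopyPrecomp {K' L : Type*} [TopologicalSpace K'] [TopologicalSpace L] (i : C(K', K)) :
    Quotient (homotopySetoid K L) → Quotient (homotopySetoid K' L) :=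
  Quotient.map' (s₁ := homotopySetoid K L) (s₂ := homotopySetoid K' L) (fun f => f.comp i)
    fun _ _ h => ContinuousMap.Homotopic.comp h (ContinuousMap.Homotopic.refl i)

variable (K) in
/-- A homotopy equivalence of targets induces a bijection between free homotopy classes. -/
def homotopyPostcomp {L L' : Type*} [TopologicalSpace L] [TopologicalSpace L']
    (e : ContinuousMap.HomotopyEquiv L L') :
    Quotient (homotopySetoid K L) ≃ Quotient (homotopySetoid K L') where
  toFun := Quotient.map' (s₁ := homotopySetoid K L) (s₂ := homotopySetoid K L')
    (fun f => e.toFun.comp f)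
    fun _ _ h => ContinuousMap.Homotopic.comp (ContinuousMap.Homotopic.refl _) h
  invFun := Quotient.map' (s₁ := homotopySetoid K L') (s₂ := homotopySetoid K L)
    (fun f => e.invFun.comp f)
    fun _ _ h => ContinuousMap.Homotopic.comp (ContinuousMap.Homotopic.refl _) h
  left_inv q := by
    induction q using Quotient.inductionOn with | h f =>
    exact Quotient.sound (s := homotopySetoid K L)
      (ContinuousMap.Homotopic.comp e.left_inv (ContinuousMap.Homotopic.refl f))
  right_inv q := by
    induction q using Quotient.inductionOn with | h f =>
    exact Quotient.sound (s := homotopySetoid K L')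
      (ContinuousMap.Homotopic.comp e.right_inv (ContinuousMap.Homotopic.refl f))

end

section

variable {X : Type*} [TopologicalSpace X] [T2Space X] [CWComplex (univ : Set X)]
  [CWComplex.FiniteType (univ : Set X)]

variable (X) in
/-- Free homotopy classes of maps from the `n`-skeleton to the loop space form the underlying set of
`LoopGroup X y n`. -/
noncomputable def loopGroupEquiv {Y : Type*} [TopologicalSpace Y] (y : Y) (n : ℕ) :
    Quotient (homotopySetoid (skel X n) (LoopSpace Y y)) ≃ LoopGroup X y n :=
  loopClassesEquiv (skel X n) y

theorem loopRes_loopGroupEquiv {Y : Type*} [TopologicalSpace Y] (y : Y) (n : ℕ)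
    (q : Quotient (homotopySetoid (skel X (n + 1)) (LoopSpace Y y))) :
    loopRes X y n (loopGroupEquiv X y (n + 1) q) =
      loopGroupEquiv X y n (homotopyPrecomp (skelIncl X n) q) := by
  induction q using Quotient.inductionOn with | h f =>
  exact loopRes_apply _

/-- The Mittag-Leffler property of the tower of the groups `LoopGroup X y n` depends only on the
homotopy type of the loop space of `Y` at `y`, since it does not involve the group structures. -/
theorem mittagLeffler_of_homotopyEquiv {Y₁ Y₂ : Type*} [TopologicalSpace Y₁] [TopologicalSpace Y₂]
    {y₁ : Y₁} {y₂ : Y₂} (e : ContinuousMap.HomotopyEquiv (LoopSpace Y₁ y₁) (LoopSpace Y₂ y₂))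
    (h : MittagLeffler fun n => loopRes X y₁ n) : MittagLeffler fun n => loopRes X y₂ n := by
  refine h.of_equiv (fun n => ((loopGroupEquiv X y₁ n).symm.trans
    (homotopyPostcomp (skel X n) e)).trans (loopGroupEquiv X y₂ n)) fun n x => ?_
  obtain ⟨q, rfl⟩ := (loopGroupEquiv X y₁ (n + 1)).surjective x
  simp only [Equiv.trans_apply, Equiv.symm_apply_apply, loopRes_loopGroupEquiv]
  congr 1
  induction q using Quotient.inductionOn with | h f =>
  rfl

end

/-! ### Triviality of phantom maps as the Mittag-Leffler condition -/

section

variable {X : Type*} [TopologicalSpace X] [T2Space X] [CWComplex (univ : Set X)]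
  {Y : Type*} [TopologicalSpace Y] {x₀ : X} (hx₀ : x₀ ∈ skel X 0) {y : Y}

theorem homotopyClass_eq_trivial_iff {A : Type*} [TopologicalSpace A] {a : A}
    (f : PointedMap a y) : f.homotopyClass = HomotopyClasses.trivial a y ↔
      f.1.HomotopicRel (ContinuousMap.const A y) {a} :=
  ⟨fun h => Quotient.exact (s := pointedHomotopySetoid a y) h,
    fun h => Quotient.sound (s := pointedHomotopySetoid a y) h⟩

/-- Pointed null-homotopies on the skeleta, as paths in the mapping spaces. -/
theorem isPhantom_iff [CWComplex.FiniteType (univ : Set X)] (f : PointedMap x₀ y) : IsPhantom hx₀ f ↔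
    ∀ n, ∃ q : Path (f.1.restrict (skel X n)) (cst X n y), ∀ t, q t (skelPt hx₀ n) = y := by
  refine forall_congr' fun n => ?_
  rw [homotopyClass_eq_trivial_iff]
  constructor
  · rintro ⟨F⟩
    refine ⟨⟨ContinuousMap.curry F.toContinuousMap, ?_, ?_⟩, fun t => ?_⟩
    · ext x; exact F.apply_zero x
    · ext x; exact F.apply_one x
    · exact (F.eq_fst t (mem_singleton _)).trans f.2
  · rintro ⟨q, hq⟩
    refine ⟨⟨⟨⟨fun x => q x.1 x.2, by fun_prop⟩, fun x => ?_, fun x => ?_⟩, fun t x hx => ?_⟩⟩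
    · exact congrArg (fun φ : C(skel X n, Y) => φ x) q.source
    · exact congrArg (fun φ : C(skel X n, Y) => φ x) q.target
    · rw [mem_singleton_iff.1 hx]
      exact (hq t).trans f.2.symm

theorem ph_eq_singleton_iff : Ph hx₀ y = {HomotopyClasses.trivial x₀ y} ↔
    ∀ f : PointedMap x₀ y, IsPhantom hx₀ f → f.1.HomotopicRel (ContinuousMap.const X y) {x₀} := by
  constructor
  · intro h f hf
    rw [← homotopyClass_eq_trivial_iff, ← mem_singleton_iff, ← h]
    exact ⟨f, hf, rfl⟩
  · intro h
    refine Subset.antisymm ?_ (singleton_subset_iff.2 ⟨PointedMap.trivial x₀ y, fun n => rfl, rfl⟩)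
    rintro _ ⟨f, hf, rfl⟩
    exact (homotopyClass_eq_trivial_iff f).2 (h f hf)

/-- For `X` of finite type and `Y` countable, all phantom maps are trivial if and only if the tower
of the groups `LoopGroup X y n` is Mittag-Leffler. -/
theorem ph_eq_singleton_iff_mittagLeffler [CWComplex.FiniteType (univ : Set X)] [T2Space Y]
    [CWComplex (univ : Set Y)] [CountableCW Y] :
    Ph hx₀ y = {HomotopyClasses.trivial x₀ y} ↔ MittagLeffler fun n => loopRes X y n := by
  rw [ph_eq_singleton_iff]
  constructor
  · intro h
    have := countable_loopGroup (X := X) y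
    refine mittagLeffler_of_exists_twisted_section (ρ := loopRes X y) ?_
    refine exists_twisted_section_of_phantom hx₀ fun f hf hq => ?_
    obtain ⟨F⟩ := h ⟨f, hf⟩ ((isPhantom_iff hx₀ ⟨f, hf⟩).2 hq)
    exact ⟨F.toHomotopy⟩
  · intro h f hf
    refine homotopicRel_const_of_mittagLeffler hx₀ f.1 f.2 h fun n => ?_
    obtain ⟨q, -⟩ := (isPhantom_iff hx₀ f).1 hf n
    exact ⟨q⟩

end

end PhantomMaps

theorem mainTheorem5
    {X : Type*} [TopologicalSpace X] [T2Space X]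
    [Topology.CWComplex (Set.univ : Set X)]
    [Topology.CWComplex.FiniteType (Set.univ : Set X)]
    {Y₁ : Type*} [TopologicalSpace Y₁] [T2Space Y₁]
    [Topology.CWComplex (Set.univ : Set Y₁)] [PhantomMaps.CountableCW Y₁]
    {Y₂ : Type*} [TopologicalSpace Y₂] [T2Space Y₂]
    [Topology.CWComplex (Set.univ : Set Y₂)] [PhantomMaps.CountableCW Y₂]
    (x₀ : X) (hx₀ : x₀ ∈ PhantomMaps.skel X 0) (y₁ : Y₁) (y₂ : Y₂)
    (hΩ : Nonempty (ContinuousMap.HomotopyEquiv (LoopSpace Y₁ y₁) (LoopSpace Y₂ y₂))) :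
    PhantomMaps.Ph hx₀ y₁ = {PhantomMaps.HomotopyClasses.trivial x₀ y₁} ↔
      PhantomMaps.Ph hx₀ y₂ = {PhantomMaps.HomotopyClasses.trivial x₀ y₂} := by
  obtain ⟨e⟩ := hΩ
  rw [PhantomMaps.ph_eq_singleton_iff_mittagLeffler, PhantomMaps.ph_eq_singleton_iff_mittagLeffler]
  exact ⟨PhantomMaps.mittagLeffler_of_homotopyEquiv e,
    PhantomMaps.mittagLeffler_of_homotopyEquiv e.symm⟩
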